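/- Let $\mathbb K$ be a field. A finite simplicial complex $\Gamma$ with finite vertex set $V=V(\Gamma)$ is a collection of subsets of $V$ (its faces) that is closed under taking subsets and contains $\varnothing$ and every singleton $\{v\}$, $v\in V$. For $T\subseteq V$, let $\Gamma_T=\{X\cap T : X\in\Gamma\}$ be the induced complex on $T$, and let $\uplus$ denote disjoint union of complexes. Let $\mathcal A$ be the $\mathbb K$-vector space with basis the isomorphism classes of finite simplicial complexes (a complex also denotes its class), with product $\Gamma\cdot\Theta=\Gamma\uplus\Theta$, unit the complex $\varnothing$ with no vertices, coproduct $\Delta(\Gamma)=\sum_{T\subseteq V(\Gamma)}\Gamma_T\otimes\Gamma_{V(\Gamma)\setminus T}$, and counit $\epsilon(\Gamma)=1$ if $V(\Gamma)=\varnothing$ and $\epsilon(\Gamma)=0$ otherwise. Then $\mathcal A$ is a Hopf algebra; let $S$ be its antipode. For a finite simple graph $G=(V,E)$, a flat of $G$ is a set $F\subseteq E$ such that each connected component of the graph $(V,F)$ is an induced subgraph of $G$; $\mathcal F(G)$ is the set of flats, $c(F)$ is the number of connected components of $(V,F)$, $G/F$ is the graph obtained from $G$ by contracting the edges in $F$ (parallel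 edges being identified), and $a(G)$ is the number of acyclic orientations of $G$. The 1-skeleton $\Gamma^{(1)}$ of a complex $\Gamma$ is regarded as a simple graph on $V(\Gamma)$, and for a flat $F$ of $\Gamma^{(1)}$, $\Gamma_{V,F}$ is the subcomplex of $\Gamma$, with the same vertex set $V=V(\Gamma)$, consisting of the faces of $\Gamma$ all of whose edges belong to $F$. **Theorem.** Let $\Gamma$ be a simplicial complex on $n\ge 1$ vertices. Then, in $\mathcal A$, $$S(\Gamma)=\sum_{F\in\mathcal F(\Gamma^{(1)})}(-1)^{c(F)}\,a(\Gamma^{(1)}/F)\,\Gamma_{V,F}.$$ Moreover, this formula is cancellation-free: each integer $(-1)^{c(F)}a(\Gamma^{(1)}/F)$ is nonzero, and if $F,F'$ are flats of $\Gamma^{(1)}$ with $\Gamma_{V,F}\cong\Gamma_{V,F'}$, then the integers $(-1)^{c(F)}a(\Gamma^{(1)}/F)$ and $(-1)^{c(F')}a(\Gamma^{(1)}/F')$ have the same sign. -/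

import Mathlib

universe u v

noncomputable section

open scoped TensorProduct

namespace AbstractSimplicialComplex

variable {V W X V' W' : Type u}

/-- The pull-back of a complex along an injection of vertex sets: a nonempty set is a face iff its
image is a face. -/
def comap (K : AbstractSimplicialComplex V) (f : W ↪ V) : AbstractSimplicialComplex W where
  faces := {s | s.map f ∈ K.faces}
  isRelLowerSet_faces := by
    intro s hs
    have h := K.isRelLowerSet_faces hs
    refine ⟨by simpa using h.1, fun t hts ht => h.2 (Finset.map_subset_map.2 hts) ?_⟩
    simpa using ht
  singleton_mem v := by simpa using K.singleton_mem (f v)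

/-- The induced complex `Γ_T` on a set `T` of vertices. Its faces are the faces of `Γ` contained
in `T`. -/
def induce (K : AbstractSimplicialComplex V) (T : Set V) : AbstractSimplicialComplex T :=
  K.comap (Function.Embedding.subtype (· ∈ T))

/-- The disjoint union `Γ ⊎ Θ`, on the disjoint union of the vertex sets. -/
def disjUnion (K : AbstractSimplicialComplex V) (L : AbstractSimplicialComplex W) :
    AbstractSimplicialComplex (V ⊕ W) where
  faces := {s | (∃ t ∈ K.faces, s = t.map Function.Embedding.inl) ∨
    ∃ t ∈ L.faces, s = t.map Function.Embedding.inr}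
  isRelLowerSet_faces := by
    rintro _ (⟨t, ht, rfl⟩ | ⟨t, ht, rfl⟩)
    · have h := K.isRelLowerSet_faces ht
      refine ⟨by simpa using h.1, fun r hr hr' => Or.inl ?_⟩
      obtain ⟨q, hq, rfl⟩ := Finset.subset_map_iff.1 hr
      exact ⟨q, h.2 hq (by simpa using hr'), rfl⟩
    · have h := L.isRelLowerSet_faces ht
      refine ⟨by simpa using h.1, fun r hr hr' => Or.inr ?_⟩
      obtain ⟨q, hq, rfl⟩ := Finset.subset_map_iff.1 hr
      exact ⟨q, h.2 hq (by simpa using hr'), rfl⟩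
  singleton_mem v := by
    rcases v with v | w
    · exact Or.inl ⟨{v}, K.singleton_mem v, by simp⟩
    · exact Or.inr ⟨{w}, L.singleton_mem w, by simp⟩

open Classical in
/-- The `1`-skeleton of a complex, as a simple graph. -/
def oneSkeleton (K : AbstractSimplicialComplex V) : SimpleGraph V where
  Adj v w := v ≠ w ∧ ({v, w} : Finset V) ∈ K.faces
  symm.symm v w h := ⟨h.1.symm, by rw [Finset.pair_comm]; exact h.2⟩
  loopless.irrefl v h := h.1 rfl

/-- The complex `Γ_{V,F}` for a set `F` of edges: the faces of `Γ` all of whose edges are in `F`. -/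
def restrictEdges (K : AbstractSimplicialComplex V) (F : Set (Sym2 V)) :
    AbstractSimplicialComplex V where
  faces := {s | s ∈ K.faces ∧ ∀ v ∈ s, ∀ w ∈ s, v ≠ w → s(v, w) ∈ F}
  isRelLowerSet_faces := by
    rintro s ⟨hs, hF⟩
    have h := K.isRelLowerSet_faces hs
    exact ⟨h.1, fun t hts ht => ⟨h.2 hts ht,
      fun v hv w hw => hF v (hts hv) w (hts hw)⟩⟩
  singleton_mem v := ⟨K.singleton_mem v, by
    intro a ha b hb hab
    rw [Finset.mem_singleton] at ha hb
    exact absurd (ha.trans hb.symm) hab⟩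

/-- Two complexes are isomorphic if a bijection of their vertex sets matches up their faces. -/
def Isomorphic (K : AbstractSimplicialComplex V) (L : AbstractSimplicialComplex W) : Prop :=
  ∃ e : V ≃ W, ∀ s : Finset V, s.map e.toEmbedding ∈ L.faces ↔ s ∈ K.faces

theorem Isomorphic.refl (K : AbstractSimplicialComplex V) : K.Isomorphic K :=
  ⟨Equiv.refl V, fun s => by simp⟩

theorem Isomorphic.symm {K : AbstractSimplicialComplex V} {L : AbstractSimplicialComplex W}
    (h : K.Isomorphic L) : L.Isomorphic K := by
  obtain ⟨e, he⟩ := h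
  exact ⟨e.symm, fun s => by rw [← he, Finset.map_map]; simp⟩

theorem Isomorphic.trans {K : AbstractSimplicialComplex V} {L : AbstractSimplicialComplex W}
    {M : AbstractSimplicialComplex X} (h : K.Isomorphic L) (h' : L.Isomorphic M) :
    K.Isomorphic M := by
  obtain ⟨e, he⟩ := h
  obtain ⟨e', he'⟩ := h'
  refine ⟨e.trans e', fun s => ?_⟩
  rw [← he, ← he', Finset.map_map]
  rfl

theorem mem_comap {K : AbstractSimplicialComplex V} {f : W ↪ V} {s : Finset W} :
    s ∈ (K.comap f).faces ↔ s.map f ∈ K.faces := Iff.rfl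


theorem mem_disjUnion {K : AbstractSimplicialComplex V} {L : AbstractSimplicialComplex W}
    {s : Finset (V ⊕ W)} : s ∈ (K.disjUnion L).faces ↔
      (∃ t ∈ K.faces, s = t.map Function.Embedding.inl) ∨
      ∃ t ∈ L.faces, s = t.map Function.Embedding.inr := Iff.rfl

theorem map_inl_mem_disjUnion {K : AbstractSimplicialComplex V} {L : AbstractSimplicialComplex W}
    {s : Finset V} : s.map Function.Embedding.inl ∈ (K.disjUnion L).faces ↔ s ∈ K.faces := by
  refine ⟨?_, fun h => Or.inl ⟨s, h, rfl⟩⟩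
  rintro (⟨t, ht, h⟩ | ⟨t, ht, h⟩)
  · rwa [Finset.map_injective _ h]
  · obtain ⟨x, hx⟩ := (L.isRelLowerSet_faces ht).1
    have hm : Function.Embedding.inr x ∈ t.map (Function.Embedding.inr : W ↪ V ⊕ W) :=
      Finset.mem_map_of_mem _ hx
    rw [← h] at hm
    simp at hm

theorem map_inr_mem_disjUnion {K : AbstractSimplicialComplex V} {L : AbstractSimplicialComplex W}
    {s : Finset W} : s.map Function.Embedding.inr ∈ (K.disjUnion L).faces ↔ s ∈ L.faces := by
  refine ⟨?_, fun h => Or.inr ⟨s, h, rfl⟩⟩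
  rintro (⟨t, ht, h⟩ | ⟨t, ht, h⟩)
  · obtain ⟨x, hx⟩ := (K.isRelLowerSet_faces ht).1
    have hm : Function.Embedding.inl x ∈ t.map (Function.Embedding.inl : V ↪ V ⊕ W) :=
      Finset.mem_map_of_mem _ hx
    rw [← h] at hm
    simp at hm
  · rwa [Finset.map_injective _ h]

/-- A criterion for a complex to be isomorphic to a disjoint union. -/
theorem isomorphic_disjUnion {K : AbstractSimplicialComplex V} {L : AbstractSimplicialComplex W}
    {M : AbstractSimplicialComplex X} (e : V ⊕ W ≃ X)
    (h1 : ∀ s : Finset V,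
      s.map (Function.Embedding.inl.trans e.toEmbedding) ∈ M.faces ↔ s ∈ K.faces)
    (h2 : ∀ s : Finset W,
      s.map (Function.Embedding.inr.trans e.toEmbedding) ∈ M.faces ↔ s ∈ L.faces)
    (h3 : ∀ t ∈ M.faces, (∃ s : Finset V, t = s.map (Function.Embedding.inl.trans e.toEmbedding)) ∨
      ∃ s : Finset W, t = s.map (Function.Embedding.inr.trans e.toEmbedding)) :
    (K.disjUnion L).Isomorphic M := by
  refine ⟨e, fun s => ⟨fun h => ?_, ?_⟩⟩
  · rcases h3 _ h with ⟨t, ht⟩ | ⟨t, ht⟩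
    · have hs : s = t.map Function.Embedding.inl := by
        apply Finset.map_injective e.toEmbedding
        rw [ht, Finset.map_map]
      rw [ht, h1] at h
      exact Or.inl ⟨t, h, hs⟩
    · have hs : s = t.map Function.Embedding.inr := by
        apply Finset.map_injective e.toEmbedding
        rw [ht, Finset.map_map]
      rw [ht, h2] at h
      exact Or.inr ⟨t, h, hs⟩
  · rintro (⟨t, ht, rfl⟩ | ⟨t, ht, rfl⟩)
    · rw [Finset.map_map]; exact (h1 t).2 ht
    · rw [Finset.map_map]; exact (h2 t).2 ht

theorem Isomorphic.disjUnion {K : AbstractSimplicialComplex V} {L : AbstractSimplicialComplex W}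
    {K' : AbstractSimplicialComplex V'} {L' : AbstractSimplicialComplex W'}
    (h : K.Isomorphic K') (h' : L.Isomorphic L') :
    (K.disjUnion L).Isomorphic (K'.disjUnion L') := by
  obtain ⟨e, he⟩ := h
  obtain ⟨f, hf⟩ := h'
  have hl : (Function.Embedding.inl.trans (Equiv.sumCongr e f).toEmbedding) =
    e.toEmbedding.trans Function.Embedding.inl := by ext; rfl
  have hr : (Function.Embedding.inr.trans (Equiv.sumCongr e f).toEmbedding) =
    f.toEmbedding.trans Function.Embedding.inr := by ext; rfl
  refine isomorphic_disjUnion (Equiv.sumCongr e f) (fun s => ?_) (fun s => ?_) ?_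
  · rw [hl, ← Finset.map_map, map_inl_mem_disjUnion, he]
  · rw [hr, ← Finset.map_map, map_inr_mem_disjUnion, hf]
  · rw [hl, hr]
    rintro _ (⟨t, ht, rfl⟩ | ⟨t, ht, rfl⟩)
    · exact Or.inl ⟨t.map e.symm.toEmbedding, by
        rw [Finset.map_map, ← Function.Embedding.trans_assoc]; simp⟩
    · exact Or.inr ⟨t.map f.symm.toEmbedding, by
        rw [Finset.map_map, ← Function.Embedding.trans_assoc]; simp⟩

theorem disjUnion_comm (K : AbstractSimplicialComplex V) (L : AbstractSimplicialComplex W) :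
    (K.disjUnion L).Isomorphic (L.disjUnion K) := by
  refine isomorphic_disjUnion (Equiv.sumComm V W) (fun s => ?_) (fun s => ?_) ?_
  · exact map_inr_mem_disjUnion
  · exact map_inl_mem_disjUnion
  · rintro _ (⟨t, ht, rfl⟩ | ⟨t, ht, rfl⟩)
    · exact Or.inr ⟨t, rfl⟩
    · exact Or.inl ⟨t, rfl⟩

theorem disjUnion_empty [IsEmpty W] (K : AbstractSimplicialComplex V)
    (L : AbstractSimplicialComplex W) : (K.disjUnion L).Isomorphic K := by
  have hl : (Function.Embedding.inl.trans (Equiv.sumEmpty V W).toEmbedding) =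
    Function.Embedding.refl V := by ext; rfl
  refine isomorphic_disjUnion (Equiv.sumEmpty V W) (fun s => ?_) (fun s => ?_) ?_
  · rw [hl, Finset.map_refl]
  · have hs : s = ∅ := Finset.eq_empty_of_isEmpty s
    subst hs
    constructor
    · intro h
      exact absurd (K.isRelLowerSet_faces h).1 (by simp)
    · intro h
      exact absurd (L.isRelLowerSet_faces h).1 (by simp)
  · intro t _
    exact Or.inl ⟨t, by rw [hl, Finset.map_refl]⟩

theorem disjUnion_assoc (K : AbstractSimplicialComplex V) (L : AbstractSimplicialComplex W)
    (M : AbstractSimplicialComplex X) :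
    ((K.disjUnion L).disjUnion M).Isomorphic (K.disjUnion (L.disjUnion M)) := by
  have hll : Function.Embedding.inl.trans (Function.Embedding.inl.trans
      (Equiv.sumAssoc V W X).toEmbedding) = Function.Embedding.inl := by ext; rfl
  have hlr : Function.Embedding.inr.trans (Function.Embedding.inl.trans
      (Equiv.sumAssoc V W X).toEmbedding) =
        Function.Embedding.inl.trans Function.Embedding.inr := by ext; rfl
  have hr : Function.Embedding.inr.trans (Equiv.sumAssoc V W X).toEmbedding =
        Function.Embedding.inr.trans Function.Embedding.inr := by ext; rfl
  refine isomorphic_disjUnion (Equiv.sumAssoc V W X) (fun s => ⟨fun h => ?_, ?_⟩) (fun s => ?_) ?_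
  · rcases h with ⟨t, ht, h⟩ | ⟨t, ht, h⟩
    · refine Or.inl ⟨t, ht, ?_⟩
      apply Finset.map_injective (Function.Embedding.inl.trans (Equiv.sumAssoc V W X).toEmbedding)
      rw [h, Finset.map_map, hll]
    · rcases ht with ⟨t, ht, rfl⟩ | ⟨t, ht, rfl⟩
      · refine Or.inr ⟨t, ht, ?_⟩
        apply Finset.map_injective
          (Function.Embedding.inl.trans (Equiv.sumAssoc V W X).toEmbedding)
        rw [h, Finset.map_map, Finset.map_map, hlr]
      · obtain ⟨x, hx⟩ := (M.isRelLowerSet_faces ht).1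
        have hm : Sum.inr (Sum.inr x) ∈ (t.map Function.Embedding.inr).map
            (Function.Embedding.inr : W ⊕ X ↪ V ⊕ (W ⊕ X)) :=
          Finset.mem_map_of_mem _ (Finset.mem_map_of_mem _ hx)
        rw [← h] at hm
        simp at hm
  · rintro (⟨t, ht, rfl⟩ | ⟨t, ht, rfl⟩)
    · rw [Finset.map_map, hll]
      exact map_inl_mem_disjUnion.2 ht
    · rw [Finset.map_map, hlr, ← Finset.map_map]
      exact map_inr_mem_disjUnion.2 (map_inl_mem_disjUnion.2 ht)
  · rw [hr, ← Finset.map_map, map_inr_mem_disjUnion, map_inr_mem_disjUnion]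
  · rintro _ (⟨t, ht, rfl⟩ | ⟨t, ht, rfl⟩)
    · exact Or.inl ⟨t.map Function.Embedding.inl, by rw [Finset.map_map, hll]⟩
    · rcases ht with ⟨t, ht, rfl⟩ | ⟨t, ht, rfl⟩
      · exact Or.inl ⟨t.map Function.Embedding.inr, by
          rw [Finset.map_map, Finset.map_map, hlr]⟩
      · exact Or.inr ⟨t, by rw [Finset.map_map, hr]⟩

theorem induce_disjUnion (K : AbstractSimplicialComplex V) (L : AbstractSimplicialComplex W)
    (T : Set V) (U : Set W) :
    ((K.induce T).disjUnion (L.induce U)).Isomorphic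
      ((K.disjUnion L).induce (Sum.inl '' T ∪ Sum.inr '' U)) := by
  let e : T ⊕ U ≃ (Sum.inl '' T ∪ Sum.inr '' U : Set (V ⊕ W)) :=
    Equiv.ofBijective (fun x => match x with
      | Sum.inl t => ⟨Sum.inl t.1, Or.inl ⟨t.1, t.2, rfl⟩⟩
      | Sum.inr t => ⟨Sum.inr t.1, Or.inr ⟨t.1, t.2, rfl⟩⟩) (by
      constructor
      · rintro (⟨a, ha⟩ | ⟨a, ha⟩) (⟨b, hb⟩ | ⟨b, hb⟩) h <;>
          simpa using congrArg Subtype.val h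
      · rintro ⟨_, ⟨a, ha, rfl⟩ | ⟨a, ha, rfl⟩⟩
        · exact ⟨Sum.inl ⟨a, ha⟩, rfl⟩
        · exact ⟨Sum.inr ⟨a, ha⟩, rfl⟩)
  have hl : (Function.Embedding.inl.trans e.toEmbedding).trans
      (Function.Embedding.subtype (· ∈ (Sum.inl '' T ∪ Sum.inr '' U : Set (V ⊕ W)))) =
      (Function.Embedding.subtype (· ∈ T)).trans Function.Embedding.inl := by
    ext; rfl
  have hr : (Function.Embedding.inr.trans e.toEmbedding).trans
      (Function.Embedding.subtype (· ∈ (Sum.inl '' T ∪ Sum.inr '' U : Set (V ⊕ W)))) =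
      (Function.Embedding.subtype (· ∈ U)).trans Function.Embedding.inr := by
    ext; rfl
  refine isomorphic_disjUnion e (fun s => ?_) (fun s => ?_) ?_
  · rw [induce, induce, mem_comap, mem_comap, Finset.map_map, hl, ← Finset.map_map,
      map_inl_mem_disjUnion]
  · rw [induce, induce, mem_comap, mem_comap, Finset.map_map, hr, ← Finset.map_map,
      map_inr_mem_disjUnion]
  · intro t ht
    rw [induce, mem_comap] at ht
    classical
    rcases ht with ⟨r, hr', h⟩ | ⟨r, hr', h⟩
    · refine Or.inl ⟨r.subtype (· ∈ T), ?_⟩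
      apply Finset.map_injective (Function.Embedding.subtype _)
      rw [Finset.map_map, hl, ← Finset.map_map, h, Finset.subtype_map_of_mem]
      intro x hx
      have : Sum.inl x ∈ r.map (Function.Embedding.inl : V ↪ V ⊕ W) := Finset.mem_map_of_mem _ hx
      rw [← h] at this
      simp only [Finset.mem_map, Function.Embedding.subtype_apply] at this
      obtain ⟨⟨y, hy⟩, -, h'⟩ := this
      simp only at h'
      subst h'
      simpa using hy
    · refine Or.inr ⟨r.subtype (· ∈ U), ?_⟩
      apply Finset.map_injective (Function.Embedding.subtype _)
      rw [Finset.map_map, hr, ← Finset.map_map, h, Finset.subtype_map_of_mem]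
      intro x hx
      have : Sum.inr x ∈ r.map (Function.Embedding.inr : W ↪ V ⊕ W) := Finset.mem_map_of_mem _ hx
      rw [← h] at this
      simp only [Finset.mem_map, Function.Embedding.subtype_apply] at this
      obtain ⟨⟨y, hy⟩, -, h'⟩ := this
      simp only at h'
      subst h'
      simpa using hy

end AbstractSimplicialComplex

/-- A finite simplicial complex together with its vertex set. -/
structure FinComplex where
  /-- the vertex set -/
  V : Type u
  [fintype : Fintype V]
  /-- the complex -/
  complex : AbstractSimplicialComplex V

attribute [instance] FinComplex.fintype

instance FinComplex.setoid : Setoid FinComplex.{u} where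
  r Γ Θ := Γ.complex.Isomorphic Θ.complex
  iseqv := ⟨fun _ => .refl _, fun h => h.symm, fun h h' => h.trans h'⟩

/-- Isomorphism classes of finite simplicial complexes. -/
def ComplexClass : Type (u + 1) := Quotient FinComplex.setoid.{u}

namespace AbstractSimplicialComplex

variable {V W : Type u} [Finite V] [Finite W]

/-- The isomorphism class `[Γ]` of a finite complex `Γ`. -/
def cls (K : AbstractSimplicialComplex V) : ComplexClass.{u} :=
  letI := Fintype.ofFinite V
  Quotient.mk _ ⟨V, K⟩

theorem cls_eq_iff {K : AbstractSimplicialComplex V} {L : AbstractSimplicialComplex W} :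
    K.cls = L.cls ↔ K.Isomorphic L := Quotient.eq

theorem cls_complex (Γ : FinComplex.{u}) : Γ.complex.cls = Quotient.mk _ Γ :=
  Quotient.sound (.refl _)

theorem cls_ind {p : ComplexClass.{u} → Prop}
    (h : ∀ (V : Type u) [Fintype V] (K : AbstractSimplicialComplex V), p K.cls)
    (x : ComplexClass.{u}) : p x := by
  induction x using Quotient.inductionOn with
  | h Γ => rw [← cls_complex]; exact h _ _

theorem cls_comap {X : Type u} (K : AbstractSimplicialComplex X) (f : W ↪ X) :
    (K.comap f).cls = (K.induce (Set.range f)).cls := by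
  refine cls_eq_iff.2 ⟨Equiv.ofInjective f f.injective, fun s => ?_⟩
  rw [induce, mem_comap, mem_comap, Finset.map_map]
  rfl

theorem cls_induce_congr (K : AbstractSimplicialComplex V) {T U : Set V} (h : T = U) :
    (K.induce T).cls = (K.induce U).cls := by
  subst h
  rfl

theorem cls_induce_induce (K : AbstractSimplicialComplex V) (T : Set V) (U : Set T) :
    ((K.induce T).induce U).cls = (K.induce (Subtype.val '' U)).cls := by
  have h := cls_comap K ((Function.Embedding.subtype (· ∈ U)).trans
    (Function.Embedding.subtype (· ∈ T)))
  have h2 : (K.induce T).induce U = K.comap ((Function.Embedding.subtype (· ∈ U)).trans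
    (Function.Embedding.subtype (· ∈ T))) := by
    ext s
    rw [induce, induce, mem_comap, mem_comap, mem_comap, Finset.map_map]
  have h3 : Set.range ((Function.Embedding.subtype (· ∈ U)).trans
    (Function.Embedding.subtype (· ∈ T))) = Subtype.val '' U := by
    ext x
    simp
  rw [h2, h]
  exact cls_induce_congr K h3

theorem cls_induce_univ (K : AbstractSimplicialComplex V) : (K.induce Set.univ).cls = K.cls :=
  cls_eq_iff.2 ⟨Equiv.Set.univ V, fun _ => Iff.rfl⟩

theorem cls_of_isEmpty [IsEmpty V] [IsEmpty W] (K : AbstractSimplicialComplex V)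
    (L : AbstractSimplicialComplex W) : K.cls = L.cls := by
  refine cls_eq_iff.2 ⟨Equiv.equivOfIsEmpty V W, fun s => ?_⟩
  have hs : s = ∅ := Finset.eq_empty_of_isEmpty s
  subst hs
  constructor
  · intro h
    exact absurd (L.isRelLowerSet_faces h).1 (by simp)
  · intro h
    exact absurd (K.isRelLowerSet_faces h).1 (by simp)

end AbstractSimplicialComplex

open AbstractSimplicialComplex

/-- Isomorphism classes form a commutative monoid under disjoint union; the unit is the class of
the complex without vertices. -/
instance ComplexClass.commMonoid : CommMonoid ComplexClass.{u} where
  mul := Quotient.map₂ (fun Γ Θ => ⟨Γ.V ⊕ Θ.V, Γ.complex.disjUnion Θ.complex⟩)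
    (fun _ _ h _ _ h' => Isomorphic.disjUnion h h')
  one := (⊥ : AbstractSimplicialComplex PEmpty.{u + 1}).cls
  mul_assoc a b c := by
    induction a, b, c using Quotient.inductionOn₃ with
    | h Γ Θ Ξ => exact Quotient.sound (disjUnion_assoc _ _ _)
  mul_comm a b := by
    induction a, b using Quotient.inductionOn₂ with
    | h Γ Θ => exact Quotient.sound (disjUnion_comm _ _)
  one_mul a := by
    induction a using Quotient.inductionOn with
    | h Γ => exact Quotient.sound ((disjUnion_comm _ _).trans (disjUnion_empty _ _))
  mul_one a := by
    induction a using Quotient.inductionOn with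
    | h Γ => exact Quotient.sound (disjUnion_empty _ _)

theorem ComplexClass.cls_mul_cls {V W : Type u} [Finite V] [Finite W]
    (K : AbstractSimplicialComplex V) (L : AbstractSimplicialComplex W) :
    K.cls * L.cls = (K.disjUnion L).cls :=
  Quotient.sound (.refl _)

theorem ComplexClass.cls_eq_one {V : Type u} [IsEmpty V] (K : AbstractSimplicialComplex V) :
    K.cls = 1 := cls_of_isEmpty _ _

/-- The underlying vector space of the Hopf algebra `𝒜` of simplicial complexes over `𝕜`: it has
the isomorphism classes of finite simplicial complexes as a basis. As an algebra it is the monoid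
algebra of these classes under disjoint union, but its coproduct is not the grouplike one, hence
the type synonym. -/
def SimplicialHopf (𝕜 : Type v) [Field 𝕜] : Type (max v (u + 1)) :=
  MonoidAlgebra 𝕜 ComplexClass.{u}

namespace SimplicialHopf

variable (𝕜 : Type v) [Field 𝕜]

instance : CommRing (SimplicialHopf.{u} 𝕜) :=
  inferInstanceAs (CommRing (MonoidAlgebra 𝕜 ComplexClass.{u}))

instance : Algebra 𝕜 (SimplicialHopf.{u} 𝕜) :=
  inferInstanceAs (Algebra 𝕜 (MonoidAlgebra 𝕜 ComplexClass.{u}))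

/-- The basis element of `𝒜` given by an isomorphism class. -/
def ofClass : ComplexClass.{u} →* SimplicialHopf.{u} 𝕜 := MonoidAlgebra.of 𝕜 ComplexClass.{u}

/-- The basis element `[Γ]` of `𝒜` given by a finite complex `Γ`. -/
def of {V : Type u} [Finite V] (K : AbstractSimplicialComplex V) : SimplicialHopf.{u} 𝕜 :=
  ofClass 𝕜 K.cls

/-- The algebra homomorphism out of `𝒜` with prescribed values on the basis. -/
def liftHom {A : Type*} [Semiring A] [Algebra 𝕜 A] (f : ComplexClass.{u} →* A) :
    SimplicialHopf.{u} 𝕜 →ₐ[𝕜] A :=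
  MonoidAlgebra.lift 𝕜 A ComplexClass.{u} f

/-- The linear map out of `𝒜` with prescribed values on the basis. -/
def liftLinear {M : Type*} [AddCommMonoid M] [Module 𝕜 M] (f : ComplexClass.{u} → M) :
    SimplicialHopf.{u} 𝕜 →ₗ[𝕜] M :=
  Finsupp.linearCombination 𝕜 f ∘ₗ
    (MonoidAlgebra.coeffLinearEquiv 𝕜 : MonoidAlgebra 𝕜 ComplexClass.{u} ≃ₗ[𝕜] _).toLinearMap

variable {𝕜}

theorem liftHom_of {A : Type*} [Semiring A] [Algebra 𝕜 A] (f : ComplexClass.{u} →* A)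
    {V : Type u} [Finite V] (K : AbstractSimplicialComplex V) :
    liftHom 𝕜 f (of 𝕜 K) = f K.cls :=
  MonoidAlgebra.lift_of f K.cls

theorem liftLinear_of {M : Type*} [AddCommMonoid M] [Module 𝕜 M] (f : ComplexClass.{u} → M)
    {V : Type u} [Finite V] (K : AbstractSimplicialComplex V) :
    liftLinear 𝕜 f (of 𝕜 K) = f K.cls := by
  refine (Finsupp.linearCombination_single 𝕜 (1 : 𝕜) K.cls).trans ?_
  rw [one_smul]

theorem algHom_ext {A : Type*} [Semiring A] [Algebra 𝕜 A] {f g : SimplicialHopf.{u} 𝕜 →ₐ[𝕜] A}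
    (h : ∀ (V : Type u) [Fintype V] (K : AbstractSimplicialComplex V), f (of 𝕜 K) = g (of 𝕜 K)) :
    f = g := by
  refine MonoidAlgebra.algHom_ext (M := ComplexClass.{u}) (fun m => ?_) ?_
  · induction m using cls_ind with
    | h V K => exact h V K
  · ext

theorem linearMap_ext {M : Type*} [AddCommMonoid M] [Module 𝕜 M]
    {f g : SimplicialHopf.{u} 𝕜 →ₗ[𝕜] M}
    (h : ∀ (V : Type u) [Fintype V] (K : AbstractSimplicialComplex V), f (of 𝕜 K) = g (of 𝕜 K)) :
    f = g := by
  refine MonoidAlgebra.lhom_ext' (M := ComplexClass.{u}) (fun m => ?_)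
  ext
  induction m using cls_ind with
  | h V K => exact h V K

theorem of_eq {V W : Type u} [Finite V] [Finite W] {K : AbstractSimplicialComplex V}
    {L : AbstractSimplicialComplex W} (h : K.cls = L.cls) : of 𝕜 K = of 𝕜 L :=
  congrArg (ofClass 𝕜) h

theorem of_mul_of {V W : Type u} [Finite V] [Finite W] (K : AbstractSimplicialComplex V)
    (L : AbstractSimplicialComplex W) : of 𝕜 K * of 𝕜 L = of 𝕜 (K.disjUnion L) := by
  rw [of, of, of, ← map_mul, ComplexClass.cls_mul_cls]

theorem of_eq_one {V : Type u} [IsEmpty V] (K : AbstractSimplicialComplex V) :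
    of 𝕜 K = 1 := by
  rw [of, ComplexClass.cls_eq_one, map_one]

theorem of_induce_of_eq_empty {V : Type u} [Finite V] (K : AbstractSimplicialComplex V)
    {T : Set V} (h : T = ∅) : of 𝕜 (K.induce T) = 1 := by
  subst h
  exact of_eq_one _

variable (𝕜) in
/-- `Σ_{T ⊆ V(Γ)} [Γ_T] ⊗ [Γ_{V(Γ) - T}]` -/
def coprod {V : Type u} [Fintype V] (K : AbstractSimplicialComplex V) :
    SimplicialHopf.{u} 𝕜 ⊗[𝕜] SimplicialHopf.{u} 𝕜 :=
  ∑ T : Set V, of 𝕜 (K.induce T) ⊗ₜ[𝕜] of 𝕜 (K.induce Tᶜ)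

/-- The restrictions of isomorphic complexes to corresponding vertex sets are isomorphic. -/
theorem cls_induce_preimage {V W : Type u} [Finite V] [Finite W]
    {K : AbstractSimplicialComplex V} {L : AbstractSimplicialComplex W} (e : V ≃ W)
    (he : ∀ s : Finset V, s.map e.toEmbedding ∈ L.faces ↔ s ∈ K.faces) (T : Set W) :
    (K.induce (e ⁻¹' T)).cls = (L.induce T).cls := by
  refine cls_eq_iff.2 ⟨e.subtypeEquiv fun _ => Iff.rfl, fun s => ?_⟩
  rw [induce, induce, mem_comap, mem_comap, ← he, Finset.map_map, Finset.map_map]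
  rfl

theorem coprod_congr {V W : Type u} [Fintype V] [Fintype W] {K : AbstractSimplicialComplex V}
    {L : AbstractSimplicialComplex W} (h : K.Isomorphic L) : coprod 𝕜 K = coprod 𝕜 L := by
  obtain ⟨e, he⟩ := h
  refine (Fintype.sum_equiv (Equiv.Set.congr e).symm _ _ fun T => ?_).symm
  have h1 : (Equiv.Set.congr e).symm T = e ⁻¹' T := by
    simp [Equiv.Set.congr, Equiv.image_eq_preimage_symm]
  rw [h1, of_eq (cls_induce_preimage e he T)]
  congr 1
  exact (of_eq (cls_induce_preimage e he Tᶜ)).symm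

theorem coprod_disjUnion {V W : Type u} [Fintype V] [Fintype W] (K : AbstractSimplicialComplex V)
    (L : AbstractSimplicialComplex W) :
    coprod 𝕜 (K.disjUnion L) = coprod 𝕜 K * coprod 𝕜 L := by
  rw [coprod, coprod, coprod, Fintype.sum_mul_sum, ← Fintype.sum_prod_type']
  refine Fintype.sum_equiv Set.sumEquiv.toEquiv _ _ fun T => ?_
  rw [Algebra.TensorProduct.tmul_mul_tmul, of_mul_of, of_mul_of]
  congr 1
  · refine of_eq ((cls_eq_iff.2 (induce_disjUnion K L _ _)).trans (cls_induce_congr _ ?_)).symm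
    ext x
    rcases x with x | x <;> simp [Set.sumEquiv]
  · refine of_eq ((cls_eq_iff.2 (induce_disjUnion K L _ _)).trans (cls_induce_congr _ ?_)).symm
    ext x
    rcases x with x | x <;> simp [Set.sumEquiv]

theorem coprod_of_isEmpty {V : Type u} [Fintype V] [IsEmpty V] (K : AbstractSimplicialComplex V) :
    coprod 𝕜 K = 1 := by
  rw [coprod, Fintype.sum_unique, of_eq_one, of_eq_one]
  rfl

variable (𝕜) in
/-- The coproduct `Δ[Γ] = Σ_{T ⊆ V(Γ)} [Γ_T] ⊗ [Γ_{V(Γ) - T}]`. -/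
def comulHom : SimplicialHopf.{u} 𝕜 →ₐ[𝕜] SimplicialHopf.{u} 𝕜 ⊗[𝕜] SimplicialHopf.{u} 𝕜 :=
  liftHom 𝕜
    { toFun := Quotient.lift (fun Γ => coprod 𝕜 Γ.complex) (fun _ _ h => coprod_congr h)
      map_one' := @coprod_of_isEmpty 𝕜 _ PEmpty.{u + 1} (_) _ _
      map_mul' := fun a b => by
        induction a, b using Quotient.inductionOn₂ with
        | h Γ Θ => exact coprod_disjUnion _ _ }

theorem comulHom_of {V : Type u} [Fintype V] (K : AbstractSimplicialComplex V) :
    comulHom 𝕜 (of 𝕜 K) = coprod 𝕜 K := by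
  rw [comulHom, liftHom_of]
  exact @coprod_congr 𝕜 _ V V (_) _ K K (.refl K)

open Classical in
variable (𝕜) in
/-- The counit: `ε[Γ]` is `1` if `Γ` has no vertices, and `0` otherwise. -/
def counitHom : SimplicialHopf.{u} 𝕜 →ₐ[𝕜] 𝕜 :=
  liftHom 𝕜
    { toFun := Quotient.lift (fun Γ => if IsEmpty Γ.V then 1 else 0) (by
        rintro Γ Θ ⟨e, -⟩
        simp only [e.isEmpty_congr])
      map_one' := if_pos (inferInstanceAs (IsEmpty PEmpty.{u + 1}))
      map_mul' := fun a b => by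
        induction a, b using Quotient.inductionOn₂ with
        | h Γ Θ =>
          change (if IsEmpty (Γ.V ⊕ Θ.V) then (1 : 𝕜) else 0) =
            (if IsEmpty Γ.V then 1 else 0) * (if IsEmpty Θ.V then 1 else 0)
          simp only [isEmpty_sum, ite_and, ite_mul, one_mul, zero_mul] }

open Classical in
theorem counitHom_of {V : Type u} [Fintype V] (K : AbstractSimplicialComplex V) :
    counitHom 𝕜 (of 𝕜 K) = if IsEmpty V then 1 else 0 := by
  rw [counitHom, liftHom_of]
  rfl

open Classical in
theorem counitHom_of_induce {V : Type u} [Fintype V] (K : AbstractSimplicialComplex V)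
    (T : Set V) : counitHom 𝕜 (of 𝕜 (K.induce T)) = if T = ∅ then 1 else 0 := by
  rw [counitHom_of]
  simp only [Set.isEmpty_coe_sort]

open Classical in
theorem sum_sets_subtype {V M : Type*} [Fintype V] [AddCommMonoid M] (T : Set V)
    [Fintype T] (f : Set V → M) :
    ∑ U : Set T, f (Subtype.val '' U) = ∑ U : Set V with U ⊆ T, f U := by
  refine Finset.sum_bij' (fun U _ => Subtype.val '' U) (fun U _ => Subtype.val ⁻¹' U)
    ?_ ?_ ?_ ?_ ?_
  · intro U _
    simp
  · intro U _
    simp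
  · intro U _
    exact Set.preimage_image_eq U Subtype.val_injective
  · intro U hU
    simpa using hU
  · intro U _
    rfl

open Classical in
theorem coprod_induce {V : Type u} [Fintype V] (K : AbstractSimplicialComplex V) (T : Set V)
    [Fintype T] :
    coprod 𝕜 (K.induce T) =
      ∑ U : Set V with U ⊆ T, of 𝕜 (K.induce U) ⊗ₜ[𝕜] of 𝕜 (K.induce (T \ U)) := by
  rw [← sum_sets_subtype T fun U => of 𝕜 (K.induce U) ⊗ₜ[𝕜] of 𝕜 (K.induce (T \ U)), coprod]
  refine Fintype.sum_congr _ _ fun U => ?_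
  congr 1
  · exact of_eq (cls_induce_induce K T U)
  · refine of_eq ((cls_induce_induce K T Uᶜ).trans (cls_induce_congr K ?_))
    ext x
    simp

theorem coassoc_of {V : Type u} [Fintype V] (K : AbstractSimplicialComplex V) :
    Algebra.TensorProduct.assoc 𝕜 𝕜 𝕜 _ _ _
      (Algebra.TensorProduct.map (comulHom 𝕜) (.id 𝕜 _) (coprod 𝕜 K)) =
    Algebra.TensorProduct.map (.id 𝕜 _) (comulHom 𝕜) (coprod 𝕜 K) := by
  classical
  rw [coprod]
  simp only [map_sum, Algebra.TensorProduct.map_tmul, comulHom_of, AlgHom.id_apply]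
  simp only [coprod_induce, TensorProduct.sum_tmul, TensorProduct.tmul_sum, map_sum,
    Algebra.TensorProduct.assoc_tmul]
  rw [Finset.sum_sigma', Finset.sum_sigma']
  refine Finset.sum_bij' (fun p _ => ⟨p.2, p.1 \ p.2⟩) (fun p _ => ⟨p.1 ∪ p.2, p.1⟩) ?_ ?_ ?_ ?_ ?_
  · rintro ⟨T, U⟩ h
    simp only [Finset.mem_sigma, Finset.mem_univ, Finset.mem_filter, true_and] at h ⊢
    exact fun x hx => hx.2
  · rintro ⟨T, U⟩ h
    simp only [Finset.mem_sigma, Finset.mem_univ, Finset.mem_filter, true_and] at h ⊢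
    exact Set.subset_union_left
  · rintro ⟨T, U⟩ h
    simp only [Finset.mem_sigma, Finset.mem_univ, Finset.mem_filter, true_and] at h ⊢
    simp [Set.union_eq_self_of_subset_left h]
  · rintro ⟨T, U⟩ h
    simp only [Finset.mem_sigma, Finset.mem_univ, Finset.mem_filter, true_and] at h ⊢
    have : (T ∪ U) \ T = U := by
      ext x
      have := @h x
      simp only [Set.mem_compl_iff] at this
      simp only [Set.mem_sdiff, Set.mem_union]
      tauto
    simp [this]
  · rintro ⟨T, U⟩ h
    simp only [Finset.mem_sigma, Finset.mem_univ, Finset.mem_filter, true_and] at h ⊢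
    congr 2
    refine of_eq (cls_induce_congr K ?_)
    ext x
    have := @h x
    simp only [Set.mem_sdiff, Set.mem_compl_iff]
    tauto

instance : Bialgebra 𝕜 (SimplicialHopf.{u} 𝕜) :=
  Bialgebra.ofAlgHom (comulHom 𝕜) (counitHom 𝕜)
    (algHom_ext fun V _ K => by
      rw [AlgHom.comp_apply, AlgHom.comp_apply, AlgHom.comp_apply, comulHom_of]
      exact coassoc_of K)
    (algHom_ext fun V _ K => by
      classical
      simp only [AlgHom.comp_apply, comulHom_of, coprod, map_sum, Algebra.TensorProduct.map_tmul,
        counitHom_of_induce, AlgHom.id_apply]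
      rw [Finset.sum_eq_single ∅ (fun T _ hT => by simp [hT]) (by simp), if_pos rfl]
      rw [of_eq ((cls_induce_congr K Set.compl_empty).trans (cls_induce_univ K))]
      rfl)
    (algHom_ext fun V _ K => by
      classical
      simp only [AlgHom.comp_apply, comulHom_of, coprod, map_sum, Algebra.TensorProduct.map_tmul,
        counitHom_of_induce, AlgHom.id_apply]
      rw [Finset.sum_eq_single Set.univ (fun T _ hT => by simp [hT]) (by simp), if_pos (by simp)]
      rw [of_eq (cls_induce_univ K)]
      rfl)

theorem comul_of {V : Type u} [Fintype V] (K : AbstractSimplicialComplex V) :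
    Coalgebra.comul (R := 𝕜) (of 𝕜 K) =
      ∑ T : Set V, of 𝕜 (K.induce T) ⊗ₜ[𝕜] of 𝕜 (K.induce Tᶜ) :=
  comulHom_of K

open Classical in
theorem counit_of {V : Type u} [Fintype V] (K : AbstractSimplicialComplex V) :
    Coalgebra.counit (R := 𝕜) (of 𝕜 K) = if IsEmpty V then 1 else 0 :=
  counitHom_of K

open Classical in
variable (𝕜) in
/-- The antipode on the basis, by the recursion available in every graded connected bialgebra:
`S[∅] = 1` and `S[Γ] = - Σ_{T ⊊ V(Γ)} S[Γ_T] [Γ_{V(Γ) - T}]` otherwise. -/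
def antipodeFun (Γ : FinComplex.{u}) : SimplicialHopf.{u} 𝕜 :=
  if IsEmpty Γ.V then 1 else
    - ∑ T : {T : Set Γ.V // T ≠ Set.univ},
      antipodeFun ⟨T.1, Γ.complex.induce T.1⟩ * of 𝕜 (Γ.complex.induce T.1ᶜ)
termination_by Fintype.card Γ.V
decreasing_by
  obtain ⟨x, hx⟩ := (Set.ne_univ_iff_exists_notMem T.1).1 T.2
  exact Fintype.card_subtype_lt hx

theorem antipodeFun_congr {Γ Θ : FinComplex.{u}} (h : Γ.complex.Isomorphic Θ.complex) :
    antipodeFun 𝕜 Γ = antipodeFun 𝕜 Θ := by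
  classical
  induction hn : Fintype.card Γ.V using Nat.strong_induction_on generalizing Γ Θ with
  | _ n ih =>
  subst hn
  obtain ⟨e, he⟩ := h
  rw [antipodeFun, antipodeFun]
  simp only [e.isEmpty_congr]
  congr 2
  have h1 (T : Set Θ.V) : (Equiv.Set.congr e).symm T = e ⁻¹' T := by
    simp [Equiv.Set.congr, Equiv.image_eq_preimage_symm]
  have h0 (T : Set Θ.V) : T ≠ Set.univ ↔ (Equiv.Set.congr e).symm T ≠ Set.univ := by
    rw [h1, Ne, Ne, Set.preimage_eq_univ_iff, e.range_eq_univ, Set.univ_subset_iff]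
  refine (Fintype.sum_equiv ((Equiv.Set.congr e).symm.subtypeEquiv h0) _ _ fun T => ?_).symm
  obtain ⟨T, hT⟩ := T
  have hT' : e ⁻¹' T ≠ Set.univ := by rw [← h1]; exact (h0 T).1 hT
  have h2 : (Equiv.Set.congr e).symm.subtypeEquiv h0 ⟨T, hT⟩ =
    (⟨e ⁻¹' T, hT'⟩ : {T : Set Γ.V // T ≠ Set.univ}) := Subtype.ext (h1 T)
  rw [h2]
  congr 1
  · refine (ih _ ?_ (cls_eq_iff.1 (cls_induce_preimage e he T)) rfl).symm
    obtain ⟨x, hx⟩ := (Set.ne_univ_iff_exists_notMem _).1 hT'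
    exact Fintype.card_subtype_lt hx
  · exact (of_eq (cls_induce_preimage e he Tᶜ)).symm

variable (𝕜) in
/-- The antipode of `𝒜`, as a linear map. -/
def antipodeLinear : SimplicialHopf.{u} 𝕜 →ₗ[𝕜] SimplicialHopf.{u} 𝕜 :=
  liftLinear 𝕜 fun x : ComplexClass.{u} =>
    Quotient.lift (antipodeFun 𝕜) (fun _ _ h => antipodeFun_congr h) x

theorem antipodeLinear_of {V : Type u} [Fintype V] (K : AbstractSimplicialComplex V) :
    antipodeLinear 𝕜 (of 𝕜 K) = antipodeFun 𝕜 ⟨V, K⟩ := by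
  rw [antipodeLinear, liftLinear_of]
  exact antipodeFun_congr (.refl K)

theorem sum_antipodeLinear_mul {V : Type u} [Fintype V] (K : AbstractSimplicialComplex V) :
    ∑ T : Set V, antipodeLinear 𝕜 (of 𝕜 (K.induce T)) * of 𝕜 (K.induce Tᶜ) =
      algebraMap 𝕜 _ (Coalgebra.counit (R := 𝕜) (of 𝕜 K)) := by
  classical
  rw [counit_of]
  rcases isEmpty_or_nonempty V with hV | hV
  · rw [Fintype.sum_unique, of_eq_one (K.induce defaultᶜ), if_pos hV, mul_one,
      antipodeLinear_of, antipodeFun, if_pos (inferInstanceAs (IsEmpty (default : Set V))), map_one]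
  · have hV' : ¬ IsEmpty V := not_isEmpty_iff.2 hV
    rw [if_neg hV', map_zero, ← Finset.add_sum_erase _ _ (Finset.mem_univ Set.univ),
      of_eq (cls_induce_univ K), antipodeLinear_of, antipodeFun, if_neg hV',
      of_induce_of_eq_empty K Set.compl_univ, mul_one, neg_add_eq_zero]
    rw [Finset.sum_subtype (p := fun T => T ≠ Set.univ) _ (fun T => by simp)]
    refine Fintype.sum_congr _ _ fun T => ?_
    rw [antipodeLinear_of]

instance : HopfAlgebra 𝕜 (SimplicialHopf.{u} 𝕜) where
  antipode := antipodeLinear 𝕜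
  mul_antipode_rTensor_comul := linearMap_ext fun V _ K => by
    simp only [LinearMap.comp_apply, comul_of, map_sum, LinearMap.rTensor_tmul,
      LinearMap.mul'_apply, Algebra.linearMap_apply]
    exact sum_antipodeLinear_mul K
  mul_antipode_lTensor_comul := linearMap_ext fun V _ K => by
    simp only [LinearMap.comp_apply, comul_of, map_sum, LinearMap.lTensor_tmul,
      LinearMap.mul'_apply, Algebra.linearMap_apply]
    rw [← sum_antipodeLinear_mul K]
    refine Fintype.sum_equiv (Equiv.ofBijective _ compl_bijective) _ _ fun T => ?_
    rw [mul_comm, Equiv.ofBijective_apply]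
    congr 1
    exact of_eq (cls_induce_congr K (compl_compl T).symm)

end SimplicialHopf

namespace SimpleGraph

variable {V : Type u}

/-- A set `F` of edges of `G` is a flat if each connected component of the graph `(V, F)` is an
induced subgraph of `G`. -/
def IsFlat (G : SimpleGraph V) (F : Set (Sym2 V)) : Prop :=
  F ⊆ G.edgeSet ∧ ∀ c : (fromEdgeSet F).ConnectedComponent,
    (fromEdgeSet F).induce c.supp = G.induce c.supp

/-- The finite set of flats of a finite graph. -/
def flats [Finite V] (G : SimpleGraph V) : Finset (Set (Sym2 V)) :=
  (Set.toFinite {F : Set (Sym2 V) | G.IsFlat F}).toFinset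

/-- The number `c(F)` of connected components of the graph `(V, F)`. -/
def numComponents (F : Set (Sym2 V)) : ℕ := Nat.card (fromEdgeSet F).ConnectedComponent

/-- The graph `G / F` obtained by contracting the edges in `F`: its vertices are the connected
components of `(V, F)`, and two distinct ones are adjacent iff an edge of `G` joins them. -/
def contract (G : SimpleGraph V) (F : Set (Sym2 V)) :
    SimpleGraph (fromEdgeSet F).ConnectedComponent :=
  G.map (fromEdgeSet F).connectedComponentMk

/-- `D` is an orientation of `G`: it contains each edge of `G` in exactly one of its two
directions, and nothing else. -/
def IsOrientation (G : SimpleGraph V) (D : Digraph V) : Prop :=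
  (∀ v w, G.Adj v w ↔ D.Adj v w ∨ D.Adj w v) ∧ ∀ v w, D.Adj v w → ¬ D.Adj w v

/-- The number `a(G)` of acyclic orientations of `G`, i.e. of those without directed cycles. -/
def numAcyclicOrientations (G : SimpleGraph V) : ℕ :=
  Nat.card {D : Digraph V // G.IsOrientation D ∧ ∀ v, ¬ Relation.TransGen D.Adj v v}

end SimpleGraph

end

/-! Write `G` for the 1-skeleton of `Γ`. A pair consisting of a flat `F` and an acyclic orientation
of `G / F` is the same as one relation `D` on the vertices: keep the edges of `F` in both directions
and every other edge in the direction prescribed by the orientation. The relations that arise are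
the partial orientations, `F` is the set of mutual edges, and `c(F)` is the number of strong
components. The right-hand side thus becomes the sum `orientationSum` of `(-1)^c Γ_{V,F}` over
partial orientations, with all multiplicities equal to one.

It remains to check the antipode recursion for this sum: the products of the sum for `Γ_T` with
`Γ_{V-T}`, added over all `T`, must vanish when `V` is nonempty. A partial orientation of `G[T]`
extends to `G` by directing the edges that meet both `T` and its complement into `T` and keeping the
edges outside `T` in both directions. The extensions are the `D` for which `T` is absorbing, and the
product of complexes is then `Γ_{V,F}` for the mutual edges `F` of `D`
(`orientationSum_induce_mul`). So for fixed `D` only the signs depend on `T`, and adding or removing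
a fixed source component of `D` is a sign-reversing involution on absorbing sets
(`sum_isAbsorbing_eq_zero`).

There is no cancellation because `c(F)` can be read off from `Γ_{V,F}`, as the number of components
of its 1-skeleton, and every finite graph has an acyclic orientation. -/

open AbstractSimplicialComplex

/-! ### Partial orientations and their strong components -/

namespace SimpleGraph

open Relation

variable {V : Type u} {G : SimpleGraph V} {D : V → V → Prop}

/-- A partial orientation of `G` keeps each edge in at least one of its two directions, such that
all edges on directed closed walks are kept in both directions. -/
structure IsPartialOrientation (G : SimpleGraph V) (D : V → V → Prop) : Prop where
  adj_iff : ∀ v w, G.Adj v w ↔ D v w ∨ D w v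
  swap : ∀ v w, D v w → ReflTransGen D w v → D w v

/-- The edges that a relation contains in both directions. -/
def mutualEdges (D : V → V → Prop) : Set (Sym2 V) :=
  Sym2.fromRel (r := fun v w => D v w ∧ D w v) ⟨fun _ _ h => ⟨h.2, h.1⟩⟩

theorem mk_mem_mutualEdges {v w : V} : s(v, w) ∈ mutualEdges D ↔ D v w ∧ D w v := Iff.rfl

/-- The connected component of a vertex in the graph of mutual edges. -/
def mutualComponent (D : V → V → Prop) (v : V) :
    (fromEdgeSet (mutualEdges D)).ConnectedComponent :=
  (fromEdgeSet (mutualEdges D)).connectedComponentMk v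

namespace IsPartialOrientation

theorem ne (h : G.IsPartialOrientation D) {v w : V} (hD : D v w) : v ≠ w :=
  ((h.adj_iff v w).2 (Or.inl hD)).ne

theorem fromEdgeSet_adj (h : G.IsPartialOrientation D) {v w : V} :
    (fromEdgeSet (mutualEdges D)).Adj v w ↔ D v w ∧ D w v := by
  rw [SimpleGraph.fromEdgeSet_adj, mk_mem_mutualEdges]
  exact ⟨fun h' => h'.1, fun h' => ⟨h', h.ne h'.1⟩⟩

/-- The components of the graph of mutual edges are the strongly connected components. -/
theorem reachable_iff (h : G.IsPartialOrientation D) {v w : V} :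
    (fromEdgeSet (mutualEdges D)).Reachable v w ↔ ReflTransGen D v w ∧ ReflTransGen D w v := by
  constructor
  · rintro ⟨p⟩
    induction p with
    | nil => exact ⟨.refl, .refl⟩
    | cons ha _ ih =>
      rw [h.fromEdgeSet_adj] at ha
      exact ⟨.head ha.1 ih.1, ih.2.tail ha.2⟩
  · rintro ⟨h1, h2⟩
    induction h1 using ReflTransGen.head_induction_on with
    | refl => rfl
    | head hvu hu ih =>
      -- The first arrow of the walk lies on a closed walk through both endpoints, so it is mutual.
      have hs := h.swap _ _ hvu (hu.trans h2)
      exact (h.fromEdgeSet_adj.2 ⟨hvu, hs⟩).reachable.trans (ih (h2.tail hvu))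

theorem mutualComponent_eq_iff (h : G.IsPartialOrientation D) {v w : V} :
    mutualComponent D v = mutualComponent D w ↔ ReflTransGen D v w ∧ ReflTransGen D w v :=
  ConnectedComponent.eq.trans h.reachable_iff

end IsPartialOrientation

/-! ### Absorbing sets: restriction and extension of partial orientations -/

/-- The restriction of a relation to a subset. -/
def restrictRel (D : V → V → Prop) (T : Set V) : T → T → Prop := fun v w => D v w

theorem ReflTransGen.of_restrictRel {T : Set V} {v w : T}
    (h : ReflTransGen (restrictRel D T) v w) : ReflTransGen D v w :=
  h.lift Subtype.val fun _ _ h => h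

theorem IsPartialOrientation.restrictRel {T : Set V} (h : G.IsPartialOrientation D) :
    (G.induce T).IsPartialOrientation (restrictRel D T) where
  adj_iff v w := h.adj_iff v w
  swap v w hvw hr := h.swap v w hvw (ReflTransGen.of_restrictRel hr)

/-- No arrow leaves `T`, and all arrows outside of `T` go in both directions. -/
structure IsAbsorbing (D : V → V → Prop) (T : Set V) : Prop where
  mem_of_rel : ∀ v w, v ∈ T → D v w → w ∈ T
  swap : ∀ v w, v ∉ T → w ∉ T → D v w → D w v

theorem isAbsorbing_univ : IsAbsorbing D Set.univ :=
  ⟨fun _ _ _ _ => trivial, fun _ _ h => absurd trivial h⟩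

namespace IsAbsorbing

variable {T : Set V}

theorem mem_of_reflTransGen (hT : IsAbsorbing D T) {v w : V} (hv : v ∈ T)
    (h : ReflTransGen D v w) : w ∈ T := by
  induction h with
  | refl => exact hv
  | tail _ h ih => exact hT.mem_of_rel _ _ ih h

/-- A walk that starts in `T` can never leave it. -/
theorem reflTransGen_restrictRel (hT : IsAbsorbing D T) {v w : T}
    (h : ReflTransGen D v w) : ReflTransGen (restrictRel D T) v w := by
  obtain ⟨w, hw⟩ := w
  change ReflTransGen D v w at h
  induction h with
  | refl => exact .refl
  | tail h h' ih => exact (ih (hT.mem_of_reflTransGen v.2 h)).tail h'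

/-- An edge between `T` and its complement can only point into `T`, and edges outside `T` are
mutual. Hence `D` is determined by its restriction to `T`. -/
theorem rel_iff (hT : IsAbsorbing D T) (h : G.IsPartialOrientation D) {v w : V} (hv : v ∉ T) :
    D v w ↔ G.Adj v w := by
  rw [h.adj_iff]
  refine ⟨Or.inl, ?_⟩
  rintro (h' | h')
  · exact h'
  · by_cases hw : w ∈ T
    · exact absurd (hT.mem_of_rel _ _ hw h') hv
    · exact hT.swap _ _ hw hv h'

/-- The number of mutual components inside of an absorbing set. -/
theorem numComponents_restrictRel (hT : IsAbsorbing D T) (h : G.IsPartialOrientation D) :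
    numComponents (mutualEdges (restrictRel D T)) = (mutualComponent D '' T).ncard := by
  let f : (fromEdgeSet (mutualEdges (restrictRel D T))).ConnectedComponent →
      (fromEdgeSet (mutualEdges D)).ConnectedComponent :=
    ConnectedComponent.lift (fun v => mutualComponent D v) fun v w p _ => by
      have hr := h.restrictRel.reachable_iff.1 p.reachable
      exact h.mutualComponent_eq_iff.2
        ⟨ReflTransGen.of_restrictRel hr.1, ReflTransGen.of_restrictRel hr.2⟩
  -- Walks of `D` between two vertices of `T` stay in `T`, so a strong component of `D` does not
  -- break up on restriction.
  have hf : Function.Injective f := by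
    intro a b
    induction a using ConnectedComponent.ind with | _ v
    induction b using ConnectedComponent.ind with | _ w
    intro hvw
    have hvw' := h.mutualComponent_eq_iff.1 hvw
    exact ConnectedComponent.eq.2 (h.restrictRel.reachable_iff.2
      ⟨hT.reflTransGen_restrictRel hvw'.1, hT.reflTransGen_restrictRel hvw'.2⟩)
  have hr : Set.range f = mutualComponent D '' T := by
    ext c
    constructor
    · rintro ⟨a, rfl⟩
      induction a using ConnectedComponent.ind with | _ v
      exact ⟨v, v.2, rfl⟩
    · rintro ⟨v, hv, rfl⟩
      exact ⟨connectedComponentMk _ ⟨v, hv⟩, rfl⟩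
  rw [← hr, ← Set.image_univ, Set.ncard_image_of_injective _ hf, Set.ncard_univ]
  rfl

end IsAbsorbing

/-- Puts the exponent of `orientationSum` into the form used for absorbing sets, with `T` the whole
vertex set. -/
theorem numComponents_mutualEdges :
    numComponents (mutualEdges D) = (mutualComponent D '' Set.univ).ncard := by
  have : mutualComponent D '' Set.univ = Set.univ := by
    rw [Set.image_univ]
    exact Set.range_eq_univ.2 Quot.mk_surjective
  rw [this, Set.ncard_univ]
  rfl

open Classical in
/-- The extension of a relation on `T` by all edges of `G` that start outside of `T`. -/
def extendRel (G : SimpleGraph V) (T : Set V) (D' : T → T → Prop) (v w : V) : Prop :=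
  if h : v ∈ T then ∃ hw : w ∈ T, D' ⟨v, h⟩ ⟨w, hw⟩ else G.Adj v w

variable {T : Set V} {D' : T → T → Prop}

theorem extendRel_of_mem {v w : V} (hv : v ∈ T) :
    extendRel G T D' v w ↔ ∃ hw : w ∈ T, D' ⟨v, hv⟩ ⟨w, hw⟩ := by
  rw [extendRel, dif_pos hv]

theorem extendRel_of_notMem {v w : V} (hv : v ∉ T) :
    extendRel G T D' v w ↔ G.Adj v w := by
  rw [extendRel, dif_neg hv]

theorem restrictRel_extendRel : restrictRel (extendRel G T D') T = D' := by
  ext v w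
  rw [restrictRel, extendRel_of_mem v.2]
  exact ⟨fun h => h.2, fun h => ⟨w.2, h⟩⟩

theorem isAbsorbing_extendRel : IsAbsorbing (extendRel G T D') T where
  mem_of_rel _ _ hv h := ((extendRel_of_mem hv).1 h).1
  swap _ _ hv hw h := (extendRel_of_notMem hw).2 ((extendRel_of_notMem hv).1 h).symm

/-- Since no arrow leaves `T`, a closed walk lies either in `T`, where the hypothesis applies, or
outside `T`, where all arrows are mutual. -/
theorem IsPartialOrientation.extendRel (h : (G.induce T).IsPartialOrientation D') :
    G.IsPartialOrientation (extendRel G T D') where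
  adj_iff v w := by
    by_cases hv : v ∈ T <;> by_cases hw : w ∈ T
    · rw [extendRel_of_mem hv, extendRel_of_mem hw]
      refine (h.adj_iff ⟨v, hv⟩ ⟨w, hw⟩).trans ?_
      simp [hv, hw]
    · rw [extendRel_of_mem hv, extendRel_of_notMem hw]
      simp [hw, G.adj_comm]
    · rw [extendRel_of_mem hw, extendRel_of_notMem hv]
      simp [hv]
    · rw [extendRel_of_notMem hv, extendRel_of_notMem hw]
      simp [G.adj_comm]
  swap v w hvw hr := by
    by_cases hv : v ∈ T
    · obtain ⟨hw, hvw⟩ := (extendRel_of_mem hv).1 hvw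
      have hr' := isAbsorbing_extendRel.reflTransGen_restrictRel
        (v := ⟨w, hw⟩) (w := ⟨v, hv⟩) hr
      rw [restrictRel_extendRel] at hr'
      exact (extendRel_of_mem hw).2 ⟨hv, h.swap _ _ hvw hr'⟩
    · have hw : w ∉ T := fun hw => hv (isAbsorbing_extendRel.mem_of_reflTransGen hw hr)
      exact isAbsorbing_extendRel.swap _ _ hv hw hvw

/-- Together with `restrictRel_extendRel`, this makes restriction and extension inverse bijections
between the partial orientations of `G` for which `T` is absorbing and those of `G[T]`. -/
theorem IsAbsorbing.extendRel_restrictRel (hT : IsAbsorbing D T) (h : G.IsPartialOrientation D) :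
    extendRel G T (restrictRel D T) = D := by
  ext v w
  by_cases hv : v ∈ T
  · rw [extendRel_of_mem hv]
    exact ⟨fun h => h.2, fun h => ⟨hT.mem_of_rel _ _ hv h, h⟩⟩
  · rw [extendRel_of_notMem hv, hT.rel_iff h hv]

/-! ### Toggling a source component -/

/-- Every relation on a nonempty finite set has a source component. -/
theorem exists_source [Finite V] [Nonempty V] (D : V → V → Prop) :
    ∃ s, ∀ v, ReflTransGen D v s → ReflTransGen D s v := by
  -- Take `s` with the fewest ancestors: an ancestor `v` of `s` has no ancestors beyond those of
  -- `s`, so by minimality it has the same ones, among them `s`.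
  obtain ⟨s, hs⟩ := Finite.exists_min fun s => {v | ReflTransGen D v s}.ncard
  refine ⟨s, fun v hv => ?_⟩
  have hsub : {u | ReflTransGen D u v} ⊆ {u | ReflTransGen D u s} := fun u hu => hu.trans hv
  have heq := Set.eq_of_subset_of_ncard_le hsub (hs v)
  have : s ∈ {u | ReflTransGen D u s} := ReflTransGen.refl
  rwa [← heq] at this

section Toggle

variable {s : V}

/-- By `hs` the ancestors of `s` are one strong component, and no arrow enters it from outside. So
no arrow of the smaller set leads into the removed part, and an arrow ending in the removed part
also starts there and is mutual. -/
theorem IsAbsorbing.sdiff (hT : IsAbsorbing D T) (h : G.IsPartialOrientation D)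
    (hs : ∀ v, ReflTransGen D v s → ReflTransGen D s v) :
    IsAbsorbing D (T \ {v | ReflTransGen D v s}) where
  mem_of_rel v w hv hvw := ⟨hT.mem_of_rel _ _ hv.1 hvw, fun hw => hv.2 (.head hvw hw)⟩
  swap v w hv hw hvw := by
    have key : ∀ x, x ∉ T \ {v | ReflTransGen D v s} → x ∈ T → ReflTransGen D x s := by
      intro x hx hxT
      by_contra hn
      exact hx ⟨hxT, hn⟩
    by_cases hwT : w ∈ T
    · have hw' := key w hw hwT
      exact h.swap _ _ hvw (hw'.trans (hs v (.head hvw hw')))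
    · have hvT : v ∉ T := fun hvT => hwT (hT.mem_of_rel _ _ hvT hvw)
      exact hT.swap _ _ hvT hwT hvw

theorem IsAbsorbing.disjoint (hT : IsAbsorbing D T) (hsT : s ∉ T) :
    Disjoint T {v | ReflTransGen D v s} :=
  Set.disjoint_left.2 fun _ hv hvs => hsT (hT.mem_of_reflTransGen hv hvs)

/-- If an arrow from an ancestor `v` of `s` to `w` stays outside `T`, it is mutual, so `w` reaches
`s` through `v`. -/
theorem IsAbsorbing.union (hT : IsAbsorbing D T) :
    IsAbsorbing D (T ∪ {v | ReflTransGen D v s}) where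
  mem_of_rel v w hv hvw := by
    by_cases hwT : w ∈ T
    · exact Or.inl hwT
    · have hvT : v ∉ T := fun hvT => hwT (hT.mem_of_rel _ _ hvT hvw)
      exact Or.inr (.head (hT.swap _ _ hvT hwT hvw) (hv.resolve_left hvT))
  swap v w hv hw hvw := hT.swap _ _ (fun h => hv (Or.inl h)) (fun h => hw (Or.inl h)) hvw

/-- The ancestors of the source `s` form a single strong component, which is new because `T` is
closed under walks and misses `s`. -/
theorem IsAbsorbing.ncard_union [Finite V] (hT : IsAbsorbing D T) (h : G.IsPartialOrientation D)
    (hs : ∀ v, ReflTransGen D v s → ReflTransGen D s v) (hsT : s ∉ T) :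
    (mutualComponent D '' (T ∪ {v | ReflTransGen D v s})).ncard =
      (mutualComponent D '' T).ncard + 1 := by
  have hC : mutualComponent D '' {v | ReflTransGen D v s} = {mutualComponent D s} := by
    ext c
    constructor
    · rintro ⟨v, hv, rfl⟩
      exact h.mutualComponent_eq_iff.2 ⟨hv, hs v hv⟩
    · rintro rfl
      exact ⟨s, .refl, rfl⟩
  have hn : mutualComponent D s ∉ mutualComponent D '' T := by
    rintro ⟨v, hv, hvs⟩
    exact hsT (hT.mem_of_reflTransGen hv (h.mutualComponent_eq_iff.1 hvs).1)
  rw [Set.image_union, hC, Set.union_singleton,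
    Set.ncard_insert_of_notMem hn ((Set.toFinite T).image _)]

open Classical in
/-- The signed number of absorbing sets vanishes: a source component can be added or removed. -/
theorem sum_isAbsorbing_eq_zero {R : Type*} [CommRing R] [Fintype V] [Nonempty V]
    (h : G.IsPartialOrientation D) :
    ∑ T : Set V with IsAbsorbing D T, (-1 : R) ^ (mutualComponent D '' T).ncard = 0 := by
  obtain ⟨s, hs⟩ := exists_source D
  have hsC : s ∈ {v | ReflTransGen D v s} := ReflTransGen.refl
  -- An absorbing set contains the source component or is disjoint from it, so removing and adding
  -- it are mutually inverse.
  have hC : ∀ T, IsAbsorbing D T → s ∈ T → {v | ReflTransGen D v s} ⊆ T :=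
    fun T hT hsT v hv => hT.mem_of_reflTransGen hsT (hs v hv)
  rw [← Finset.sum_filter_add_sum_filter_not _ (fun T => s ∈ T), Finset.filter_filter,
    Finset.filter_filter, add_eq_zero_iff_eq_neg, ← Finset.sum_neg_distrib]
  refine Finset.sum_bij' (fun T _ => T \ {v | ReflTransGen D v s})
    (fun T _ => T ∪ {v | ReflTransGen D v s}) ?_ ?_ ?_ ?_ ?_
  · intro T hT
    simp only [Finset.mem_filter, Finset.mem_univ, true_and] at hT ⊢
    exact ⟨hT.1.sdiff h hs, fun h' => h'.2 hsC⟩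
  · intro T hT
    simp only [Finset.mem_filter, Finset.mem_univ, true_and] at hT ⊢
    exact ⟨hT.1.union, Or.inr hsC⟩
  · intro T hT
    simp only [Finset.mem_filter, Finset.mem_univ, true_and] at hT
    exact Set.sdiff_union_of_subset (hC T hT.1 hT.2)
  · intro T hT
    simp only [Finset.mem_filter, Finset.mem_univ, true_and] at hT
    exact Set.union_sdiff_cancel_right (Set.disjoint_iff.1 (hT.1.disjoint hT.2))
  · intro T hT
    simp only [Finset.mem_filter, Finset.mem_univ, true_and] at hT
    have h' := (hT.1.sdiff h hs).ncard_union h hs (fun h' => h'.2 hsC)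
    rw [Set.sdiff_union_of_subset (hC T hT.1 hT.2)] at h'
    rw [h', pow_succ, mul_neg_one]

end Toggle

end SimpleGraph

/-! ### Splitting `Γ_{V,F}` along an absorbing set -/

namespace AbstractSimplicialComplex

open SimpleGraph

variable {V : Type u} (Γ : AbstractSimplicialComplex V)

theorem mem_restrictEdges {F : Set (Sym2 V)} {s : Finset V} :
    s ∈ (Γ.restrictEdges F).faces ↔ s ∈ Γ.faces ∧ ∀ v ∈ s, ∀ w ∈ s, v ≠ w → s(v, w) ∈ F :=
  Iff.rfl

theorem oneSkeleton_adj_of_mem {s : Finset V} (hs : s ∈ Γ.faces) {v w : V} (hv : v ∈ s)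
    (hw : w ∈ s) (hvw : v ≠ w) : Γ.oneSkeleton.Adj v w := by
  classical
  refine ⟨hvw, (Γ.isRelLowerSet_faces hs).2 (Finset.insert_subset hv ?_) ⟨v, ?_⟩⟩
  · exact Finset.singleton_subset_iff.2 hw
  · exact Finset.mem_insert_self _ _

theorem oneSkeleton_induce (T : Set V) :
    (Γ.induce T).oneSkeleton = Γ.oneSkeleton.induce T := by
  ext v w
  refine and_congr Subtype.coe_ne_coe.symm ?_
  rw [induce, mem_comap]
  refine iff_of_eq (congrArg (· ∈ Γ.faces) ?_)
  ext x
  simp only [Finset.mem_map, Finset.mem_insert, Finset.mem_singleton]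
  refine ⟨?_, ?_⟩
  · rintro ⟨a, rfl | rfl, rfl⟩
    · exact Or.inl rfl
    · exact Or.inr rfl
  · rintro (rfl | rfl)
    · exact ⟨v, Or.inl rfl, rfl⟩
    · exact ⟨w, Or.inr rfl, rfl⟩

/-- A complex whose faces avoid the edges between `T` and its complement is a disjoint union. -/
theorem isomorphic_restrictEdges {D : V → V → Prop} {T : Set V}
    (h : Γ.oneSkeleton.IsPartialOrientation D) (hT : IsAbsorbing D T) :
    (((Γ.induce T).restrictEdges (mutualEdges (restrictRel D T))).disjUnion
      (Γ.induce Tᶜ)).Isomorphic (Γ.restrictEdges (mutualEdges D)) := by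
  classical
  have hl : Function.Embedding.inl.trans (Equiv.Set.sumCompl T).toEmbedding =
      Function.Embedding.subtype (· ∈ T) := by ext; simp
  have hr : Function.Embedding.inr.trans (Equiv.Set.sumCompl T).toEmbedding =
      Function.Embedding.subtype (· ∈ Tᶜ) := by ext; simp
  refine isomorphic_disjUnion (Equiv.Set.sumCompl T) (fun s => ?_) (fun s => ?_) fun t ht => ?_
  · rw [hl, mem_restrictEdges, mem_restrictEdges]
    refine and_congr Iff.rfl ⟨fun H v hv w hw hvw => ?_, fun H => ?_⟩
    · exact H v (Finset.mem_map_of_mem _ hv) w (Finset.mem_map_of_mem _ hw)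
        (Subtype.coe_ne_coe.2 hvw)
    · simp only [Finset.mem_map]
      rintro _ ⟨v, hv, rfl⟩ _ ⟨w, hw, rfl⟩ hvw
      exact H v hv w hw (Subtype.coe_ne_coe.1 hvw)
  -- All edges outside `T` are mutual, so the restriction to mutual edges removes no face there.
  · rw [hr, mem_restrictEdges]
    refine ⟨fun H => H.1, fun H => ⟨H, ?_⟩⟩
    intro v hv w hw hvw
    have ha := Γ.oneSkeleton_adj_of_mem H hv hw hvw
    simp only [Finset.mem_map] at hv hw
    obtain ⟨v, -, rfl⟩ := hv
    obtain ⟨w, -, rfl⟩ := hw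
    exact ⟨(hT.rel_iff h v.2).2 ha, (hT.rel_iff h w.2).2 ha.symm⟩
  · rw [hl, hr]
    rw [mem_restrictEdges] at ht
    -- The edges of the face `t` are mutual and no arrow leaves `T`, so `t` lies in `T` as soon as
    -- it meets `T`.
    by_cases hm : ∃ v ∈ t, v ∈ T
    · obtain ⟨v, hv, hvT⟩ := hm
      refine Or.inl ⟨t.subtype (· ∈ T), (Finset.subtype_map_of_mem fun w hw => ?_).symm⟩
      by_cases hvw : v = w
      · exact hvw ▸ hvT
      · exact hT.mem_of_rel v w hvT (ht.2 v hv w hw hvw).1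
    · push Not at hm
      exact Or.inr ⟨t.subtype (· ∈ Tᶜ), (Finset.subtype_map_of_mem hm).symm⟩

end AbstractSimplicialComplex

/-! ### The antipode recursion for the signed sum -/

namespace SimplicialHopf

open SimpleGraph

variable {𝕜 : Type v} [Field 𝕜]

open Classical in
variable (𝕜) in
/-- The signed sum of the complexes `Γ_{V,F}` over all partial orientations of the `1`-skeleton,
where `F` is the set of edges that are kept in both directions. -/
noncomputable def orientationSum {V : Type u} [Fintype V] (Γ : AbstractSimplicialComplex V) :
    SimplicialHopf.{u} 𝕜 :=
  ∑ D : V → V → Prop with Γ.oneSkeleton.IsPartialOrientation D,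
    (-1 : 𝕜) ^ numComponents (mutualEdges D) • of 𝕜 (Γ.restrictEdges (mutualEdges D))

-- Reindexes along the bijection between restriction and extension. The condition on `T` is placed
-- inside the sum, so that the range of `D` does not depend on `T` and the sums over `D` and `T` can
-- be exchanged.
open Classical in
theorem orientationSum_induce_mul {V : Type u} [Fintype V] (Γ : AbstractSimplicialComplex V)
    (T : Set V) [Fintype T] :
    orientationSum 𝕜 (Γ.induce T) * of 𝕜 (Γ.induce Tᶜ) =
      ∑ D : V → V → Prop with Γ.oneSkeleton.IsPartialOrientation D,
        if IsAbsorbing D T then (-1 : 𝕜) ^ (mutualComponent D '' T).ncard •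
          of 𝕜 (Γ.restrictEdges (mutualEdges D)) else 0 := by
  rw [orientationSum, Finset.sum_mul, ← Finset.sum_filter, Finset.filter_filter,
    oneSkeleton_induce]
  refine Finset.sum_bij' (fun D _ => extendRel Γ.oneSkeleton T D) (fun D _ => restrictRel D T)
    ?_ ?_ ?_ ?_ ?_
  · intro D hD
    simp only [Finset.mem_filter, Finset.mem_univ, true_and] at hD ⊢
    exact ⟨hD.extendRel, isAbsorbing_extendRel⟩
  · intro D hD
    simp only [Finset.mem_filter, Finset.mem_univ, true_and] at hD ⊢
    exact hD.1.restrictRel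
  · intro D _
    exact restrictRel_extendRel
  · intro D hD
    simp only [Finset.mem_filter, Finset.mem_univ, true_and] at hD
    exact hD.2.extendRel_restrictRel hD.1
  · intro D hD
    simp only [Finset.mem_filter, Finset.mem_univ, true_and] at hD
    have hA : IsAbsorbing (extendRel Γ.oneSkeleton T D) T := isAbsorbing_extendRel
    have h1 := hA.numComponents_restrictRel hD.extendRel
    have h2 := Γ.isomorphic_restrictEdges hD.extendRel hA
    rw [restrictRel_extendRel] at h1 h2
    rw [smul_mul_assoc, of_mul_of, h1, of_eq (cls_eq_iff.2 h2)]

open Classical in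
theorem sum_orientationSum_mul {V : Type u} [Fintype V] [Nonempty V]
    (Γ : AbstractSimplicialComplex V) :
    ∑ T : Set V, orientationSum 𝕜 (Γ.induce T) * of 𝕜 (Γ.induce Tᶜ) = 0 := by
  simp only [orientationSum_induce_mul]
  rw [Finset.sum_comm]
  refine Finset.sum_eq_zero fun D hD => ?_
  simp only [Finset.mem_filter, Finset.mem_univ, true_and] at hD
  rw [← Finset.sum_filter, ← Finset.sum_smul, sum_isAbsorbing_eq_zero hD, zero_smul]

/-- The top term of the recursion. As a case of the product formula it does not need the invariance
of `orientationSum` under isomorphism. -/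
theorem orientationSum_induce_univ_mul {V : Type u} [Fintype V] [Fintype (Set.univ : Set V)]
    (Γ : AbstractSimplicialComplex V) :
    orientationSum 𝕜 (Γ.induce Set.univ) * of 𝕜 (Γ.induce Set.univᶜ) = orientationSum 𝕜 Γ := by
  classical
  rw [orientationSum_induce_mul, orientationSum]
  refine Finset.sum_congr rfl fun D _ => ?_
  rw [if_pos isAbsorbing_univ, numComponents_mutualEdges]

theorem orientationSum_of_isEmpty {V : Type u} [Fintype V] [IsEmpty V]
    (Γ : AbstractSimplicialComplex V) : orientationSum 𝕜 Γ = 1 := by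
  classical
  rw [orientationSum, Finset.sum_eq_single (fun _ _ => False)]
  · rw [numComponents_mutualEdges, Set.eq_empty_of_isEmpty Set.univ, Set.image_empty,
      Set.ncard_empty, pow_zero, one_smul, of_eq_one]
  · intro D _ hD
    exact absurd (Subsingleton.elim _ _) hD
  · intro h
    refine absurd ?_ h
    simp only [Finset.mem_filter, Finset.mem_univ, true_and]
    exact ⟨fun v => isEmptyElim v, fun v => isEmptyElim v⟩

/-- For nonempty `V` the antipode and `orientationSum` satisfy the same vanishing identity. Its
terms for proper subsets agree by induction on the number of vertices, which forces the terms for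
the whole of `V` to agree. -/
theorem antipode_of_eq_orientationSum {V : Type u} [Fintype V] (Γ : AbstractSimplicialComplex V) :
    HopfAlgebra.antipode 𝕜 (of 𝕜 Γ) = orientationSum 𝕜 Γ := by
  classical
  change antipodeLinear 𝕜 (of 𝕜 Γ) = orientationSum 𝕜 Γ
  induction hn : Fintype.card V using Nat.strong_induction_on generalizing V with
  | _ n ih =>
  subst hn
  rcases isEmpty_or_nonempty V with hV | hV
  · rw [orientationSum_of_isEmpty, antipodeLinear_of, antipodeFun, if_pos hV]
  · have hS := sum_antipodeLinear_mul (𝕜 := 𝕜) Γ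
    rw [counit_of, if_neg (not_isEmpty_iff.2 hV), map_zero,
      ← sum_orientationSum_mul (𝕜 := 𝕜) Γ, ← Finset.add_sum_erase _ _ (Finset.mem_univ Set.univ),
      ← Finset.add_sum_erase _ _ (Finset.mem_univ Set.univ),
      @orientationSum_induce_univ_mul 𝕜 _ V _ (_) Γ,
      of_eq (cls_induce_univ Γ), of_induce_of_eq_empty Γ Set.compl_univ, mul_one] at hS
    refine add_right_cancel (hS.trans (congrArg _ (Finset.sum_congr rfl fun T hT => ?_)))
    obtain ⟨x, hx⟩ := (Set.ne_univ_iff_exists_notMem T).1 (Finset.ne_of_mem_erase hT)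
    rw [ih _ (Fintype.card_subtype_lt (p := (· ∈ T)) hx) (Γ.induce T) rfl]

end SimplicialHopf

/-! ### Flats and acyclic orientations of contractions -/

namespace SimpleGraph

open Relation

variable {V : Type u} {G : SimpleGraph V} {F : Set (Sym2 V)}

theorem mem_flats [Finite V] : F ∈ G.flats ↔ G.IsFlat F := by
  rw [flats, Set.Finite.mem_toFinset, Set.mem_ofPred_eq]

/-- A flat is determined by its partition of the vertices: it consists of all edges of `G` inside
the blocks. -/
theorem IsFlat.adj_iff (hF : G.IsFlat F) {v w : V} :
    (fromEdgeSet F).Adj v w ↔ G.Adj v w ∧ (fromEdgeSet F).connectedComponentMk v =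
      (fromEdgeSet F).connectedComponentMk w := by
  constructor
  · intro h
    exact ⟨hF.1 ((fromEdgeSet_adj F).1 h).1, ConnectedComponent.eq.2 h.reachable⟩
  · rintro ⟨h, h'⟩
    have := congrFun₂ (congrArg Adj (hF.2 (connectedComponentMk _ w))) ⟨v, h'⟩ ⟨w, rfl⟩
    exact this.mpr h

theorem IsFlat.mem_iff (hF : G.IsFlat F) {v w : V} :
    s(v, w) ∈ F ↔ G.Adj v w ∧ (fromEdgeSet F).connectedComponentMk v =
      (fromEdgeSet F).connectedComponentMk w := by
  rw [← hF.adj_iff, fromEdgeSet_adj]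
  exact ⟨fun h => ⟨h, (hF.1 h : G.Adj v w).ne⟩, fun h => h.1⟩

/-- Components of mutual edges are strongly connected, so every edge of `G` inside one lies on a
closed walk and is therefore mutual. -/
theorem IsPartialOrientation.isFlat {D : V → V → Prop} (h : G.IsPartialOrientation D) :
    G.IsFlat (mutualEdges D) := by
  constructor
  · intro e
    induction e with | _ v w
    exact fun he => (h.adj_iff v w).2 (Or.inl he.1)
  · intro c
    ext v w
    refine h.fromEdgeSet_adj.trans ?_
    have hr : (fromEdgeSet (mutualEdges D)).Reachable v w :=
      ConnectedComponent.eq.1 (v.2.trans w.2.symm)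
    have hr := h.reachable_iff.1 hr
    refine Iff.trans ?_ (h.adj_iff v w).symm
    exact ⟨fun h' => Or.inl h'.1, fun h' => h'.elim (fun h' => ⟨h', h.swap _ _ h' hr.2⟩)
      fun h' => ⟨h.swap _ _ h' hr.1, h'⟩⟩

/-- The relation on vertices that keeps the edges in `F` in both directions and the other edges in
the direction prescribed by an orientation of the contraction. -/
def liftOrientation (G : SimpleGraph V) (F : Set (Sym2 V))
    (O : Digraph (fromEdgeSet F).ConnectedComponent) (v w : V) : Prop :=
  G.Adj v w ∧ ((fromEdgeSet F).connectedComponentMk v = (fromEdgeSet F).connectedComponentMk w ∨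
    O.Adj ((fromEdgeSet F).connectedComponentMk v) ((fromEdgeSet F).connectedComponentMk w))

section Lift

variable {O : Digraph (fromEdgeSet F).ConnectedComponent}

theorem reflTransGen_of_liftOrientation {v w : V}
    (h : ReflTransGen (liftOrientation G F O) v w) :
    ReflTransGen O.Adj ((fromEdgeSet F).connectedComponentMk v)
      ((fromEdgeSet F).connectedComponentMk w) := by
  induction h with
  | refl => exact .refl
  | tail _ h ih =>
    rcases h.2 with h | h
    · exact h ▸ ih
    · exact ih.tail h

theorem isPartialOrientation_liftOrientation (hO : (G.contract F).IsOrientation O)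
    (ha : ∀ c, ¬ TransGen O.Adj c c) :
    G.IsPartialOrientation (liftOrientation G F O) where
  adj_iff v w := by
    refine ⟨fun h => ?_, fun h => h.elim (fun h => h.1) fun h => h.1.symm⟩
    by_cases hc : (fromEdgeSet F).connectedComponentMk v = (fromEdgeSet F).connectedComponentMk w
    · exact Or.inl ⟨h, Or.inl hc⟩
    · exact ((hO.1 _ _).1 ((map_adj' _ _ _ _).2 ⟨hc, v, w, h, rfl, rfl⟩)).imp
        (fun h' => ⟨h, Or.inr h'⟩) (fun h' => ⟨h.symm, Or.inr h'⟩)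
  swap v w h hr := by
    refine ⟨h.1.symm, Or.inl ?_⟩
    rcases h.2 with h' | h'
    · exact h'.symm
    -- An arrow between different components, followed by the projection of the return walk, would
    -- be a directed cycle of `O`.
    · exact absurd (TransGen.head' h' (reflTransGen_of_liftOrientation hr)) (ha _)

theorem mutualEdges_liftOrientation (hF : G.IsFlat F) (hO : (G.contract F).IsOrientation O) :
    mutualEdges (liftOrientation G F O) = F := by
  ext e
  induction e with | _ v w
  rw [hF.mem_iff, mk_mem_mutualEdges]
  constructor
  · rintro ⟨⟨h, h1 | h1⟩, -, h2 | h2⟩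
    · exact ⟨h, h1⟩
    · exact ⟨h, h1⟩
    · exact ⟨h, h2.symm⟩
    · exact absurd h2 (hO.2 _ _ h1)
  · rintro ⟨h, h'⟩
    exact ⟨⟨h, Or.inl h'⟩, h.symm, Or.inl h'.symm⟩

/-- Recovers `O` from its lift, because every edge of the contraction comes from an edge of `G`.
This gives the injectivity of the lift. -/
theorem adj_iff_liftOrientation (hO : (G.contract F).IsOrientation O)
    (c c' : (fromEdgeSet F).ConnectedComponent) :
    O.Adj c c' ↔ c ≠ c' ∧ ∃ v w, liftOrientation G F O v w ∧
      (fromEdgeSet F).connectedComponentMk v = c ∧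
      (fromEdgeSet F).connectedComponentMk w = c' := by
  constructor
  · intro h
    obtain ⟨hne, v, w, hvw, rfl, rfl⟩ := (map_adj' _ _ _ _).1 ((hO.1 _ _).2 (Or.inl h))
    exact ⟨hne, v, w, ⟨hvw, Or.inr h⟩, rfl, rfl⟩
  · rintro ⟨hne, v, w, h, rfl, rfl⟩
    exact h.2.resolve_left hne

end Lift

/-- The digraph that a relation on the vertices induces on the contraction. -/
def contractRel (F : Set (Sym2 V)) (D : V → V → Prop) :
    Digraph (fromEdgeSet F).ConnectedComponent where
  Adj c c' := c ≠ c' ∧ ∃ v w, D v w ∧ (fromEdgeSet F).connectedComponentMk v = c ∧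
      (fromEdgeSet F).connectedComponentMk w = c'

section Contract

variable {D : V → V → Prop}

/-- Walks lift from the contraction: consecutive arrows are joined by walks inside the strongly
connected components. -/
theorem IsPartialOrientation.reflTransGen_of_contractRel (h : G.IsPartialOrientation D)
    {c c' : (fromEdgeSet (mutualEdges D)).ConnectedComponent}
    (hc : ReflTransGen (contractRel (mutualEdges D) D).Adj c c') :
    ∀ v w, mutualComponent D v = c → mutualComponent D w = c' → ReflTransGen D v w := by
  induction hc with
  | refl =>
    intro v w hv hw
    exact (h.mutualComponent_eq_iff.1 (hv.trans hw.symm)).1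
  | tail _ hcc ih =>
    intro v w hv hw
    obtain ⟨-, x, y, hxy, hx, hy⟩ := hcc
    exact ((ih v x hv hx).tail hxy).trans (h.mutualComponent_eq_iff.1 (hy.trans hw.symm)).1

theorem IsPartialOrientation.isOrientation_contractRel (h : G.IsPartialOrientation D) :
    (G.contract (mutualEdges D)).IsOrientation (contractRel (mutualEdges D) D) := by
  constructor
  · intro c c'
    refine (map_adj' _ _ _ _).trans ⟨?_, ?_⟩
    · rintro ⟨hne, v, w, hvw, rfl, rfl⟩
      exact ((h.adj_iff v w).1 hvw).imp (fun h' => ⟨hne, v, w, h', rfl, rfl⟩)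
        fun h' => ⟨hne.symm, w, v, h', rfl, rfl⟩
    · rintro (⟨hne, v, w, h', rfl, rfl⟩ | ⟨hne, v, w, h', rfl, rfl⟩)
      · exact ⟨hne, v, w, (h.adj_iff _ _).2 (Or.inl h'), rfl, rfl⟩
      · exact ⟨hne.symm, w, v, (h.adj_iff _ _).2 (Or.inr h'), rfl, rfl⟩
  · rintro c c' ⟨hne, v, w, hvw, rfl, rfl⟩ hc
    exact hne (h.mutualComponent_eq_iff.2 ⟨.single hvw,
      h.reflTransGen_of_contractRel (.single hc) _ _ rfl rfl⟩)

/-- The first arrow of a cycle joins two different components, but the rest of the cycle lifts to a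
walk back and would make them one. -/
theorem IsPartialOrientation.acyclic_contractRel (h : G.IsPartialOrientation D)
    (c : (fromEdgeSet (mutualEdges D)).ConnectedComponent) :
    ¬ TransGen (contractRel (mutualEdges D) D).Adj c c := by
  intro hc
  obtain ⟨c', ⟨hne, v, w, hvw, rfl, rfl⟩, hc'⟩ := TransGen.head'_iff.1 hc
  exact hne (h.mutualComponent_eq_iff.2 ⟨.single hvw,
    h.reflTransGen_of_contractRel hc' _ _ rfl rfl⟩)

theorem IsPartialOrientation.liftOrientation_contractRel (h : G.IsPartialOrientation D) :
    liftOrientation G (mutualEdges D) (contractRel (mutualEdges D) D) = D := by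
  ext v w
  constructor
  · rintro ⟨hvw, hc | ⟨hne, x, y, hxy, hx, hy⟩⟩
    · have hr := h.mutualComponent_eq_iff.1 hc
      exact ((h.adj_iff v w).1 hvw).elim id fun h' => h.swap _ _ h' hr.1
    -- All edges between two given components point the same way: if the edge were kept from `w` to
    -- `v`, the walk from `v` via `x` and `y` to `w` would close it up and force the arrow from `v`
    -- to `w` as well.
    · refine ((h.adj_iff v w).1 hvw).elim id fun h' => h.swap _ _ h' ?_
      exact (h.mutualComponent_eq_iff.1 hx).2.trans
        (.head hxy (h.mutualComponent_eq_iff.1 hy).1)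
  · intro hvw
    refine ⟨(h.adj_iff v w).2 (Or.inl hvw), ?_⟩
    exact or_iff_not_imp_left.2 fun hne => ⟨hne, v, w, hvw, rfl, rfl⟩

end Contract

/-- The partial orientations with the flat `F` of mutual edges correspond to the acyclic
orientations of the contraction `G / F`. -/
theorem IsFlat.card_isPartialOrientation (hF : G.IsFlat F) :
    Nat.card {D : V → V → Prop // G.IsPartialOrientation D ∧ mutualEdges D = F} =
      (G.contract F).numAcyclicOrientations := by
  symm
  refine Nat.card_eq_of_bijective (fun O => ⟨liftOrientation G F O.1,
    isPartialOrientation_liftOrientation O.2.1 O.2.2,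
    mutualEdges_liftOrientation hF O.2.1⟩) ⟨?_, ?_⟩
  · rintro ⟨O, hO⟩ ⟨O', hO'⟩ h
    have h : liftOrientation G F O = liftOrientation G F O' := congrArg Subtype.val h
    refine Subtype.ext (Digraph.ext (funext₂ fun c c' => propext ?_))
    rw [adj_iff_liftOrientation hO.1, adj_iff_liftOrientation hO'.1, h]
  · rintro ⟨D, hD, rfl⟩
    exact ⟨⟨contractRel _ D, hD.isOrientation_contractRel, hD.acyclic_contractRel⟩,
      Subtype.ext hD.liftOrientation_contractRel⟩

/-- Every finite graph has an acyclic orientation. -/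
theorem numAcyclicOrientations_pos [Finite V] (G : SimpleGraph V) :
    0 < G.numAcyclicOrientations := by
  have : Finite (Digraph V) :=
    Finite.of_injective (fun D : Digraph V => D.Adj) fun _ _ h => Digraph.ext h
  obtain ⟨n, ⟨e⟩⟩ := Finite.exists_equiv_fin V
  -- Every edge is directed upwards along an arbitrary numbering of the vertices.
  refine Nat.card_pos_iff.2 ⟨⟨⟨⟨fun v w => G.Adj v w ∧ e v < e w⟩, ⟨?_, ?_⟩, ?_⟩⟩, inferInstance⟩
  · intro v w
    refine ⟨fun h => ?_, fun h => h.elim (fun h => h.1) fun h => h.1.symm⟩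
    exact (lt_or_gt_of_ne (e.injective.ne h.ne)).imp (fun h' => ⟨h, h'⟩) fun h' => ⟨h.symm, h'⟩
  · exact fun v w h h' => lt_asymm h.2 h'.2
  · intro v h
    have : ∀ w, TransGen (fun v w => G.Adj v w ∧ e v < e w) v w → e v < e w := by
      intro w h
      induction h with
      | single h => exact h.2
      | tail _ h ih => exact ih.trans h.2
    exact lt_irrefl _ (this v h)

end SimpleGraph

/-! ### Reading off `c(F)` from the isomorphism class of `Γ_{V,F}` -/

namespace AbstractSimplicialComplex

open SimpleGraph

variable {V W : Type u}

theorem Isomorphic.card_connectedComponent {K : AbstractSimplicialComplex V}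
    {L : AbstractSimplicialComplex W} (h : K.Isomorphic L) :
    Nat.card K.oneSkeleton.ConnectedComponent = Nat.card L.oneSkeleton.ConnectedComponent := by
  classical
  obtain ⟨e, he⟩ := h
  let f : K.oneSkeleton ≃g L.oneSkeleton :=
    { toEquiv := e
      map_rel_iff' := fun {v w} => by
        refine and_congr e.injective.ne_iff ?_
        rw [← he, Finset.map_insert, Finset.map_singleton]
        rfl }
  exact Nat.card_congr f.connectedComponentEquiv

theorem oneSkeleton_restrictEdges (Γ : AbstractSimplicialComplex V) {F : Set (Sym2 V)}
    (hF : F ⊆ Γ.oneSkeleton.edgeSet) :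
    (Γ.restrictEdges F).oneSkeleton = fromEdgeSet F := by
  classical
  ext v w
  rw [fromEdgeSet_adj]
  constructor
  · rintro ⟨hne, -, h⟩
    exact ⟨h v (by simp) w (by simp) hne, hne⟩
  · rintro ⟨h, hne⟩
    refine ⟨hne, (hF h).2, ?_⟩
    simp only [Finset.mem_insert, Finset.mem_singleton]
    rintro a (rfl | rfl) b (rfl | rfl) hab
    · exact absurd rfl hab
    · exact h
    · rwa [Sym2.eq_swap]
    · exact absurd rfl hab

end AbstractSimplicialComplex

/-! ### The antipode formula and the absence of cancellation -/

theorem SimplicialHopf.orientationSum_eq {𝕜 : Type v} [Field 𝕜] {V : Type u} [Fintype V]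
    (Γ : AbstractSimplicialComplex V) :
    SimplicialHopf.orientationSum 𝕜 Γ =
      ∑ F ∈ Γ.oneSkeleton.flats,
        ((-1 : 𝕜) ^ SimpleGraph.numComponents F *
          ((Γ.oneSkeleton.contract F).numAcyclicOrientations : 𝕜)) •
            SimplicialHopf.of 𝕜 (Γ.restrictEdges F) := by
  classical
  -- Group the partial orientations by their flat of mutual edges: the summand is constant on each
  -- fibre, and the fibre over `F` has `a(G / F)` elements.
  rw [orientationSum, ← Finset.sum_fiberwise_of_maps_to (t := Γ.oneSkeleton.flats)
    (g := SimpleGraph.mutualEdges)]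
  · refine Finset.sum_congr rfl fun F hF => ?_
    have hF : Γ.oneSkeleton.IsFlat F := SimpleGraph.mem_flats.1 hF
    rw [Finset.filter_filter, Finset.sum_congr rfl
      (g := fun _ => (-1 : 𝕜) ^ SimpleGraph.numComponents F • of 𝕜 (Γ.restrictEdges F)),
      Finset.sum_const, ← hF.card_isPartialOrientation, Nat.card_eq_fintype_card,
      Fintype.card_subtype, mul_comm, mul_smul, Nat.cast_smul_eq_nsmul]
    intro D hD
    rw [(Finset.mem_filter.1 hD).2.2]
  · intro D hD
    exact SimpleGraph.mem_flats.2 (Finset.mem_filter.1 hD).2.isFlat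

theorem mainTheorem1 (𝕜 : Type v) [Field 𝕜] {V : Type u} [Finite V] [Nonempty V]
    (Γ : AbstractSimplicialComplex V) :
    -- the formula for the antipode
    HopfAlgebra.antipode 𝕜 (SimplicialHopf.of 𝕜 Γ) =
      ∑ F ∈ Γ.oneSkeleton.flats,
        ((-1 : 𝕜) ^ SimpleGraph.numComponents F *
          ((Γ.oneSkeleton.contract F).numAcyclicOrientations : 𝕜)) •
            SimplicialHopf.of 𝕜 (Γ.restrictEdges F) ∧
    -- it is cancellation-free: the integer coefficients of the terms that belong to the same basis
    -- element are nonzero and of the same sign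
    ∀ F ∈ Γ.oneSkeleton.flats, ∀ F' ∈ Γ.oneSkeleton.flats,
      (Γ.restrictEdges F).Isomorphic (Γ.restrictEdges F') →
        0 < ((-1 : ℤ) ^ SimpleGraph.numComponents F *
            ((Γ.oneSkeleton.contract F).numAcyclicOrientations : ℤ)) *
          ((-1 : ℤ) ^ SimpleGraph.numComponents F' *
            ((Γ.oneSkeleton.contract F').numAcyclicOrientations : ℤ)) := by
  constructor
  · have := Fintype.ofFinite V
    rw [SimplicialHopf.antipode_of_eq_orientationSum, SimplicialHopf.orientationSum_eq]
  · intro F hF F' hF' h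
    have hF : Γ.oneSkeleton.IsFlat F := SimpleGraph.mem_flats.1 hF
    have hF' : Γ.oneSkeleton.IsFlat F' := SimpleGraph.mem_flats.1 hF'
    have hc := h.card_connectedComponent
    rw [oneSkeleton_restrictEdges Γ hF.1, oneSkeleton_restrictEdges Γ hF'.1] at hc
    have hc : SimpleGraph.numComponents F = SimpleGraph.numComponents F' := hc
    have h1 := (Γ.oneSkeleton.contract F).numAcyclicOrientations_pos
    have h2 := (Γ.oneSkeleton.contract F').numAcyclicOrientations_pos
    -- With equal numbers of components the two signs multiply to `1`, leaving a product of two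
    -- positive numbers.
    rw [hc, mul_mul_mul_comm, ← mul_pow, neg_one_mul, neg_neg, one_pow, one_mul]
    exact_mod_cast Nat.mul_pos h1 h2
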